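/- Let $\Sigma$ be a set of prime numbers, let $S\subset\mathbb{N}$ be the multiplicative monoid generated by $\Sigma$, and let $\mathbb{Z}[S^{-1}]\subset\mathbb{Q}$ be the localization of $\mathbb{Z}$ at $S$, regarded as a discrete ring. Let $\mathbb{A}_{\mathbb{Z}[S^{-1}]}=\mathbb{R}\times\prod'_{q\in\Sigma}(\mathbb{Q}_q,\mathbb{Z}_q)$ be the associated adele ring (restricted product topology), into which $\mathbb{Z}[S^{-1}]$ embeds diagonally. Let $L$ be a locally compact Hausdorff topological $\mathbb{A}_{\mathbb{Z}[S^{-1}]}$-module (so scalar multiplication $\mathbb{A}_{\mathbb{Z}[S^{-1}]}\times L\to L$ is continuous), regarded also as a topological $\mathbb{Z}[S^{-1}]$-module by restriction of scalars. Then there are an integer $n\ge 0$ and integers $n_q\ge 0$ for $q\in\Sigma$ such that $$L\;\cong\;\mathbb{R}^n\times{\prod_{q\in\Sigma}}'\,(\mathbb{Q}_q^{n_q},\mathbb{Z}_q^{n_q})$$ as topological $\mathbb{Z}[S^{-1}]$-modules, where $\mathbb{Z}[S^{-1}]$ acts coordinatewise on the right-hand side. In particular: (1) $L$ is self-dual: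 $L$ is isomorphic, as a topological $\mathbb{Z}[S^{-1}]$-module, to its Pontryagin dual $\widehat{L}$ (continuous characters $L\to\mathbb{S}^1$ with the compact-open topology, and action $(r\chi)(x)=\chi(rx)$); (2) $L$ is compactly generated over $\mathbb{Z}[S^{-1}]$: there is a compact subset $K\subset L$ that generates $L$ as a $\mathbb{Z}[S^{-1}]$-module; (3) $L$ has no small $\mathbb{Z}[S^{-1}]$-submodules: there is a neighbourhood of $0$ in $L$ whose only $\mathbb{Z}[S^{-1}]$-submodule is $\{0\}$. -/

import Mathlib

open scoped RestrictedProduct Topology nonZeroDivisors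

noncomputable section

namespace LocAdele

instance factPrime (P : Set Nat.Primes) (q : P) : Fact ((q : Nat.Primes) : ℕ).Prime :=
  ⟨(q : Nat.Primes).2⟩

/-! ### The localization of the integers at a set of primes -/

/-- The multiplicative submonoid of the positive integers generated by the primes in `P`. -/
def primeMonoid (P : Set Nat.Primes) : Submonoid ℕ :=
  Submonoid.closure ((fun q : Nat.Primes => (q : ℕ)) '' P)

/-- `primeMonoid P`, viewed inside the integers. -/
def intPrimeMonoid (P : Set Nat.Primes) : Submonoid ℤ :=
  (primeMonoid P).map (Nat.castRingHom ℤ)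

theorem zero_notMem_primeMonoid (P : Set Nat.Primes) : (0 : ℕ) ∉ primeMonoid P := by
  have h : primeMonoid P ≤ ℕ⁰ := by
    refine Submonoid.closure_le.2 ?_
    rintro _ ⟨q, -, rfl⟩
    exact mem_nonZeroDivisors_of_ne_zero q.2.ne_zero
  intro h0
  exact nonZeroDivisors.ne_zero (h h0) rfl

theorem intPrimeMonoid_le (P : Set Nat.Primes) : intPrimeMonoid P ≤ ℤ⁰ := by
  rintro _ ⟨s, hs, rfl⟩
  refine mem_nonZeroDivisors_of_ne_zero fun h => zero_notMem_primeMonoid P ?_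
  have h' : s = 0 := by simpa using h
  exact h' ▸ hs

/-- The ring `ℤ[S⁻¹] ⊆ ℚ`, where `S` is the monoid generated by `P`: the subring of all fractions
`a / s` with `a ∈ ℤ` and `s ∈ S`. -/
abbrev ZLoc (P : Set Nat.Primes) : Subalgebra ℤ ℚ :=
  Localization.subalgebra.ofField ℚ (intPrimeMonoid P) (intPrimeMonoid_le P)

/-- A rational number is a `q`-adic integer for all but finitely many `q`. -/
theorem eventually_norm_le_one (P : Set Nat.Primes) (r : ℚ) :
    ∀ᶠ q : P in Filter.cofinite, ‖((r : ℚ) : ℚ_[((q : Nat.Primes) : ℕ)])‖ ≤ 1 := by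
  have hfin : Set.Finite {q : P | ((q : Nat.Primes) : ℕ) ∣ r.den} := by
    refine Set.Finite.of_finite_image (f := fun q : P => ((q : Nat.Primes) : ℕ)) ?_ ?_
    · refine (Set.finite_Iic r.den).subset ?_
      rintro _ ⟨q, hq, rfl⟩
      exact Nat.le_of_dvd r.den_pos hq
    · intro a _ b _ hab
      exact Subtype.ext (Subtype.ext hab)
  refine hfin.subset ?_
  intro q hq
  by_contra hnd
  exact hq (Padic.norm_rat_le_one hnd)

/-! ### Adele rings -/

/-- The finite adele ring of `ℤ[S⁻¹]`: the restricted product of the topological rings `ℚ_q`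
relative to `ℤ_q`, for `q ∈ P`. -/
abbrev FinAdele (P : Set Nat.Primes) : Type :=
  Πʳ q : P, [ℚ_[((q : Nat.Primes) : ℕ)], PadicInt.subring ((q : Nat.Primes) : ℕ)]

/-- The adele ring of `ℤ[S⁻¹]`. -/
abbrev Adele (P : Set Nat.Primes) : Type := ℝ × FinAdele P

/-- The diagonal embedding of `ℤ[S⁻¹]` into the finite adele ring. -/
def toFinAdele (P : Set Nat.Primes) : ZLoc P →+* FinAdele P where
  toFun r := ⟨fun q => ((r : ℚ) : ℚ_[((q : Nat.Primes) : ℕ)]), eventually_norm_le_one P r⟩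
  map_one' := by ext q; exact Rat.cast_one
  map_mul' a b := by ext q; exact Rat.cast_mul _ _
  map_zero' := by ext q; exact Rat.cast_zero
  map_add' a b := by ext q; exact Rat.cast_add _ _

instance finAdeleAlgebra (P : Set Nat.Primes) : Algebra (ZLoc P) (FinAdele P) :=
  (toFinAdele P).toAlgebra

/-! ### Restricted products of finite dimensional `q`-adic vector spaces -/

/-- The compact open subgroup `ℤ_q ^ k` of `ℚ_q ^ k`. -/
def padicLattice (q : ℕ) [Fact q.Prime] (k : ℕ) : AddSubgroup (Fin k → ℚ_[q]) where
  carrier := {x | ∀ i, x i ∈ PadicInt.subring q}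
  zero_mem' _ := zero_mem _
  add_mem' hx hy i := add_mem (hx i) (hy i)
  neg_mem' hx i := neg_mem (hx i)

/-- The restricted product of the groups `ℚ_q ^ (d q)` relative to `ℤ_q ^ (d q)`, for `q ∈ P`. -/
abbrev PadicPowers (P : Set Nat.Primes) (d : P → ℕ) : Type :=
  Πʳ q : P, [Fin (d q) → ℚ_[((q : Nat.Primes) : ℕ)], padicLattice ((q : Nat.Primes) : ℕ) (d q)]

/-- `ℤ[S⁻¹]` acts on the restricted product coordinatewise. -/
instance padicPowersModule (P : Set Nat.Primes) (d : P → ℕ) :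
    Module (ZLoc P) (PadicPowers P d) where
  smul r x := ⟨fun q i => ((r : ℚ) : ℚ_[((q : Nat.Primes) : ℕ)]) * x q i, by
    filter_upwards [eventually_norm_le_one P r, x.eventually] with q hr hx i
    exact (PadicInt.subring _).mul_mem hr (hx i)⟩
  one_smul x := by
    ext q i
    change ((1 : ℚ) : ℚ_[((q : Nat.Primes) : ℕ)]) * x q i = x q i
    simp
  mul_smul a b x := by
    ext q i
    change (((a : ℚ) * (b : ℚ) : ℚ) : ℚ_[((q : Nat.Primes) : ℕ)]) * x q i =
      ((a : ℚ) : ℚ_[((q : Nat.Primes) : ℕ)]) * (((b : ℚ) : ℚ_[((q : Nat.Primes) : ℕ)]) * x q i)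
    rw [Rat.cast_mul, mul_assoc]
  smul_zero a := by
    ext q i
    exact mul_zero _
  smul_add a x y := by
    ext q i
    exact mul_add _ _ _
  add_smul a b x := by
    ext q i
    change (((a : ℚ) + (b : ℚ) : ℚ) : ℚ_[((q : Nat.Primes) : ℕ)]) * x q i =
      ((a : ℚ) : ℚ_[((q : Nat.Primes) : ℕ)]) * x q i +
        ((b : ℚ) : ℚ_[((q : Nat.Primes) : ℕ)]) * x q i
    rw [Rat.cast_add, add_mul]
  zero_smul x := by
    ext q i
    change ((0 : ℚ) : ℚ_[((q : Nat.Primes) : ℕ)]) * x q i = 0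
    simp

/-! ### Topological modules -/

/-- A topological module over the adele ring is a topological module over `ℤ[S⁻¹]` (a discrete
ring, so that only the multiplication by each scalar has to be continuous). -/
instance continuousConstSMul_ZLoc (P : Set Nat.Primes) (L : Type*) [AddCommGroup L]
    [TopologicalSpace L] [Module (Adele P) L] [ContinuousSMul (Adele P) L]
    [Module (ZLoc P) L] [IsScalarTower (ZLoc P) (Adele P) L] :
    ContinuousConstSMul (ZLoc P) L where
  continuous_const_smul r := by
    have h : (fun x : L => r • x) = fun x : L => (r • (1 : Adele P)) • x := by
      funext x
      rw [smul_assoc, one_smul]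
    rw [h]
    exact continuous_const_smul (r • (1 : Adele P))

/-- The Pontryagin dual of a topological abelian group, written additively: the continuous
characters with values in the unit circle, with the compact-open topology. -/
abbrev CharDual (M : Type*) [AddCommGroup M] [TopologicalSpace M] : Type _ :=
  Additive (PontryaginDual (Multiplicative M))

/-- Multiplication by a scalar, as a continuous endomorphism. -/
def smulHom {R : Type*} (M : Type*) [CommRing R] [AddCommGroup M] [TopologicalSpace M]
    [Module R M] [ContinuousConstSMul R M] (r : R) : Multiplicative M →ₜ* Multiplicative M where
  toFun x := Multiplicative.ofAdd (r • x.toAdd)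
  map_one' := congrArg Multiplicative.ofAdd (smul_zero r)
  map_mul' x y := congrArg Multiplicative.ofAdd (smul_add r x.toAdd y.toAdd)
  continuous_toFun :=
    continuous_ofAdd.comp ((continuous_const_smul r).comp continuous_toAdd)

/-- The module structure on the dual: `(r • χ) m = χ (r • m)`. -/
instance charDualModule (R M : Type*) [CommRing R] [AddCommGroup M] [TopologicalSpace M]
    [Module R M] [ContinuousConstSMul R M] : Module R (CharDual M) where
  smul r χ := Additive.ofMul (PontryaginDual.map (smulHom M r) χ.toMul)
  one_smul χ := by
    apply Additive.toMul.injective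
    ext x
    exact congrArg (fun y => ((χ.toMul (Multiplicative.ofAdd y) : Circle) : ℂ))
      (one_smul R x.toAdd)
  mul_smul a b χ := by
    apply Additive.toMul.injective
    ext x
    refine congrArg (fun y => ((χ.toMul (Multiplicative.ofAdd y) : Circle) : ℂ)) ?_
    change (a * b) • x.toAdd = b • a • x.toAdd
    rw [mul_comm, mul_smul]
  smul_zero a := by
    apply Additive.toMul.injective
    ext x
    rfl
  smul_add a χ ψ := by
    apply Additive.toMul.injective
    ext x
    rfl
  add_smul a b χ := by
    apply Additive.toMul.injective
    ext x
    refine congrArg (fun z : Circle => (z : ℂ)) ?_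
    change χ.toMul (Multiplicative.ofAdd ((a + b) • x.toAdd)) =
      χ.toMul (Multiplicative.ofAdd (a • x.toAdd)) * χ.toMul (Multiplicative.ofAdd (b • x.toAdd))
    rw [add_smul, ofAdd_add, map_mul]
  zero_smul χ := by
    apply Additive.toMul.injective
    ext x
    refine congrArg (fun z : Circle => (z : ℂ)) ?_
    change χ.toMul (Multiplicative.ofAdd ((0 : R) • x.toAdd)) = 1
    rw [zero_smul, ofAdd_zero, map_one]

/-- A topological module is self-dual if it is isomorphic, as a topological module, to its
Pontryagin dual. -/
def IsSelfDual (R M : Type*) [CommRing R] [AddCommGroup M] [TopologicalSpace M]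
    [Module R M] [ContinuousConstSMul R M] : Prop :=
  Nonempty (M ≃L[R] CharDual M)

/-- A topological module is compactly generated if it is generated, as a module, by a compact
subset. -/
def IsCompactlyGenerated (R M : Type*) [CommRing R] [AddCommGroup M] [TopologicalSpace M]
    [Module R M] : Prop :=
  ∃ K : Set M, IsCompact K ∧ Submodule.span R K = ⊤

/-- A topological module has no small submodules if some neighbourhood of `0` contains no
submodule other than the trivial one. -/
def HasNoSmallSubmodules (R M : Type*) [CommRing R] [AddCommGroup M] [TopologicalSpace M]
    [Module R M] : Prop :=
  ∃ V ∈ 𝓝 (0 : M), ∀ N : Submodule R M, (N : Set M) ⊆ V → N = ⊥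

end LocAdele

end

noncomputable section

namespace LocAdele

/-! ### Corners of modules -/

section Corner

variable {F A : Type*} [CommRing F] [CommRing A]

/-! The idempotents `(1, 0)` and `(0, 1)` split `L` into a real part and a module over the finite
adeles. The real part is a locally compact real vector space, hence finite dimensional. In the
finite part `M` each prime `q` has its own idempotent, whose corner is a locally compact, hence
finite dimensional, `ℚ_q`-space.

The corners still have to be glued with the right topology. This uses a compact open submodule `H`
of `M` over the integral adeles (`exists_isCompact_isOpen_submodule`). Its trace on each corner is a
lattice, so coordinates can be chosen in which it becomes `ℤ_q ^ d_q` (`exists_equiv_lattice`). The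
coordinate map then carries `H` homeomorphically onto the product of these lattices, and `M` onto
their restricted product (`exists_padicPowers_equiv`).

Self-duality requires no explicit pairing. The dual of `L` is again a locally compact adelic module,
so it is classified by the same dimensions, and these agree with those of `L`: a corner of the dual
is the dual of the corner, and duals over `ℝ` and `ℚ_q` preserve dimension because each field has a
generating character (`finrank_charDual`).

Generation and the absence of small submodules hold for any compact neighbourhood of `0`: `1 / m`
contracts the real part and a denominator `s` contracts the finite part, while the inverse
operations `m` and `1 / s` lie in `ℤ[S⁻¹]`. -/

/-- For a non-unital ring homomorphism `e : F → A`, the submodule of an `A`-module cut out by the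
idempotent `e 1`. It is an `F`-module through `e`. -/
def Corner (e : F →ₙ+* A) (M : Type*) [AddCommGroup M] [Module A M] : Submodule A M where
  carrier := {x | e 1 • x = x}
  add_mem' {x y} hx hy := by
    change e 1 • (x + y) = x + y
    rw [smul_add, show e 1 • x = x from hx, show e 1 • y = y from hy]
  zero_mem' := smul_zero _
  smul_mem' a x hx := by
    change e 1 • a • x = a • x
    rw [smul_comm, show e 1 • x = x from hx]

variable (e : F →ₙ+* A) {M : Type*} [AddCommGroup M] [Module A M]

theorem mem_corner {x : M} : x ∈ Corner e M ↔ e 1 • x = x := Iff.rfl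

theorem smul_mem_corner (t : F) (x : M) : e t • x ∈ Corner e M := by
  rw [mem_corner, smul_smul, ← map_mul, one_mul]

instance cornerModule : Module F (Corner e M) where
  smul t x := e t • x
  one_smul x := Subtype.ext x.2
  mul_smul a b x := by
    change e (a * b) • x = e a • e b • x
    rw [map_mul, mul_smul]
  smul_zero a := smul_zero (e a)
  smul_add a x y := smul_add (e a) x y
  add_smul a b x := by
    change e (a + b) • x = e a • x + e b • x
    rw [map_add, add_smul]
  zero_smul x := by
    change e 0 • x = 0
    rw [map_zero, zero_smul]

/-- The projection of a module to a corner. -/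
def cornerProj : M →+ Corner e M where
  toFun x := ⟨e 1 • x, smul_mem_corner e 1 x⟩
  map_zero' := Subtype.ext (smul_zero _)
  map_add' x y := Subtype.ext (smul_add _ x y)

@[simp]
theorem coe_cornerProj (x : M) : (cornerProj e x : M) = e 1 • x := rfl

theorem cornerProj_coe (x : Corner e M) : cornerProj e (x : M) = x := Subtype.ext x.2

theorem cornerProj_smul (t : F) (a : A) (h : e 1 * a = e t) (x : M) :
    cornerProj e (a • x) = t • cornerProj e x := by
  refine Subtype.ext ?_
  change e 1 • a • x = e t • e 1 • x
  rw [smul_smul, smul_smul, h, ← map_mul, mul_one]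

/-- A corner of a corner is a corner. -/
def cornerCorner {B : Type*} [CommRing B] (f : B →ₙ+* A) (e : F →ₙ+* B) :
    Corner e (Corner f M) ≃ₗ[F] Corner (f.comp e) M where
  toFun x := ⟨x.1.1, congrArg Subtype.val x.2⟩
  map_add' _ _ := rfl
  map_smul' _ _ := rfl
  invFun x := ⟨⟨x.1, by
    have h : f (e 1) • x.1 = x.1 := x.2
    rw [mem_corner, ← h, smul_smul, ← map_mul, one_mul]⟩, Subtype.ext x.2⟩
  left_inv _ := rfl
  right_inv _ := rfl

variable [TopologicalSpace M]

theorem continuous_cornerProj [ContinuousConstSMul A M] :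
    Continuous (cornerProj e : M → Corner e M) :=
  (continuous_const_smul (e 1)).subtype_mk _

theorem isClosed_corner [ContinuousConstSMul A M] [T2Space M] : IsClosed (Corner e M : Set M) :=
  isClosed_eq (continuous_const_smul (e 1)) continuous_id

instance corner_locallyCompactSpace [ContinuousConstSMul A M] [T2Space M] [LocallyCompactSpace M] :
    LocallyCompactSpace (Corner e M) :=
  (isClosed_corner e).isClosedEmbedding_subtypeVal.locallyCompactSpace

instance corner_isTopologicalAddGroup [IsTopologicalAddGroup M] :
    IsTopologicalAddGroup (Corner e M) :=
  inferInstanceAs (IsTopologicalAddGroup (Corner e M).toAddSubgroup)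

/-- This turns a corner into a topological vector space, so that local compactness can force finite
dimension. -/
theorem corner_continuousSMul [TopologicalSpace F] [TopologicalSpace A] [ContinuousSMul A M]
    (he : Continuous e) : ContinuousSMul F (Corner e M) where
  continuous_smul :=
    ((he.comp continuous_fst).smul (continuous_subtype_val.comp continuous_snd)).subtype_mk _

end Corner

/-! ### The finite adele ring -/

theorem isCompact_padicInt (p : ℕ) [Fact p.Prime] :
    IsCompact (PadicInt.subring p : Set ℚ_[p]) :=
  isCompact_iff_compactSpace.2 (PadicInt.compactSpace p)

theorem isOpen_padicInt (p : ℕ) [Fact p.Prime] : IsOpen (PadicInt.subring p : Set ℚ_[p]) := by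
  convert (PadicInt.isOpenEmbedding_coe (p := p)).isOpen_range
  exact Subtype.range_coe.symm

variable (P : Set Nat.Primes)

instance fact_isOpen_subring :
    Fact (∀ q : P, IsOpen (PadicInt.subring ((q : Nat.Primes) : ℕ) :
      Set ℚ_[((q : Nat.Primes) : ℕ)])) :=
  ⟨fun _ => isOpen_padicInt _⟩

/-- The ring of integral finite adeles. -/
def intAdele : Subring (FinAdele P) where
  carrier := {a | ∀ q : P, a q ∈ PadicInt.subring ((q : Nat.Primes) : ℕ)}
  mul_mem' ha hb q := mul_mem (ha q) (hb q)
  one_mem' _ := one_mem _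
  add_mem' ha hb q := add_mem (ha q) (hb q)
  zero_mem' _ := zero_mem _
  neg_mem' ha q := neg_mem (ha q)

/-- By Tychonoff: the integral adeles are the image of `∏ ℤ_q` under the continuous structure map.
-/
theorem isCompact_intAdele : IsCompact (intAdele P : Set (FinAdele P)) := by
  have : ∀ q : P, CompactSpace (PadicInt.subring ((q : Nat.Primes) : ℕ)) := fun q =>
    isCompact_iff_compactSpace.1 (isCompact_padicInt _)
  have h := isCompact_range (RestrictedProduct.isEmbedding_structureMap
    (R := fun q : P => ℚ_[((q : Nat.Primes) : ℕ)])
    (A := fun q : P => (PadicInt.subring ((q : Nat.Primes) : ℕ) : Set _))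
    (𝓕 := Filter.cofinite)).continuous
  rw [RestrictedProduct.range_structureMap] at h
  exact h

variable {P}

theorem mem_intAdele {a : FinAdele P} :
    a ∈ intAdele P ↔ ∀ q : P, a q ∈ PadicInt.subring ((q : Nat.Primes) : ℕ) := Iff.rfl

/-- Near `0` the restricted product looks like `∏ ℤ_q` with the product topology, so only finitely
many coordinates are constrained beyond integrality. -/
theorem exists_finset_of_mem_nhds_zero {W : Set (FinAdele P)} (hW : W ∈ 𝓝 (0 : FinAdele P)) :
    ∃ (F : Finset P) (U : ∀ q : P, Set ℚ_[((q : Nat.Primes) : ℕ)]), (∀ q, U q ∈ 𝓝 0) ∧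
      ∀ a ∈ intAdele P, (∀ q ∈ F, a q ∈ U q) → a ∈ W := by
  have h0 := RestrictedProduct.nhds_zero_eq_map_structureMap
    (R := fun q : P => ℚ_[((q : Nat.Primes) : ℕ)])
    (B := fun q : P => PadicInt.subring ((q : Nat.Primes) : ℕ)) (fun _ => isOpen_padicInt _)
  replace hW := h0.ge hW
  rw [Filter.mem_map, nhds_pi, Filter.mem_pi'] at hW
  obtain ⟨F, t, ht, hs⟩ := hW
  have hU : ∀ q : P, ∃ U ∈ 𝓝 (0 : ℚ_[((q : Nat.Primes) : ℕ)]), Subtype.val ⁻¹' U ⊆ t q := by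
    intro q
    have := ht q
    rwa [nhds_subtype_eq_comap, Filter.mem_comap] at this
  choose U hU hUt using hU
  refine ⟨F, U, hU, fun a ha haF => ?_⟩
  exact @hs (fun q => ⟨a q, mem_intAdele.1 ha q⟩) fun q hq => hUt q (haF q hq)

open Classical in
/-- The inclusion of a factor of the finite adele ring. -/
def padicIncl (q : P) : ℚ_[((q : Nat.Primes) : ℕ)] →ₙ+* FinAdele P where
  toFun t := ⟨Pi.single q t, by
    refine (Set.finite_singleton q).subset fun r hr => ?_
    by_contra hrq
    refine hr ?_
    change Pi.single (M := fun r : P => ℚ_[((r : Nat.Primes) : ℕ)]) q t r ∈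
      PadicInt.subring ((r : Nat.Primes) : ℕ)
    rw [Pi.single_eq_of_ne hrq]
    exact zero_mem _⟩
  map_mul' s t := by
    ext r
    exact congrFun (Pi.single_mul (α := fun r : P => ℚ_[((r : Nat.Primes) : ℕ)]) q s t) r
  map_zero' := by
    ext r
    exact congrFun (Pi.single_zero (M := fun r : P => ℚ_[((r : Nat.Primes) : ℕ)]) q) r
  map_add' s t := by
    ext r
    exact congrFun (Pi.single_add (f := fun r : P => ℚ_[((r : Nat.Primes) : ℕ)]) q s t) r

@[simp]
theorem padicIncl_same (q : P) (t : ℚ_[((q : Nat.Primes) : ℕ)]) : padicIncl q t q = t :=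
  Pi.single_eq_same (M := fun r : P => ℚ_[((r : Nat.Primes) : ℕ)]) q t

theorem padicIncl_of_ne {q r : P} (h : r ≠ q) (t : ℚ_[((q : Nat.Primes) : ℕ)]) :
    padicIncl q t r = 0 :=
  Pi.single_eq_of_ne (M := fun r : P => ℚ_[((r : Nat.Primes) : ℕ)]) h t

theorem padicIncl_mem_intAdele {q : P} {t : ℚ_[((q : Nat.Primes) : ℕ)]}
    (ht : t ∈ PadicInt.subring ((q : Nat.Primes) : ℕ)) : padicIncl q t ∈ intAdele P := by
  change ∀ r : P, padicIncl q t r ∈ PadicInt.subring ((r : Nat.Primes) : ℕ)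
  intro r
  by_cases h : r = q
  · subst h
    rwa [padicIncl_same]
  · rw [padicIncl_of_ne h]
    exact zero_mem _

theorem padicIncl_one_mul (q : P) (a : FinAdele P) : padicIncl q 1 * a = padicIncl q (a q) := by
  ext r
  rw [RestrictedProduct.mul_apply]
  by_cases h : r = q
  · subst h
    rw [padicIncl_same, padicIncl_same, one_mul]
  · rw [padicIncl_of_ne h, padicIncl_of_ne h, zero_mul]

theorem padicIncl_mul_of_ne {q r : P} (h : q ≠ r) (s : ℚ_[((q : Nat.Primes) : ℕ)])
    (t : ℚ_[((r : Nat.Primes) : ℕ)]) : padicIncl q s * padicIncl r t = 0 := by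
  ext u
  rw [RestrictedProduct.mul_apply]
  by_cases hu : u = q
  · subst hu
    rw [padicIncl_of_ne h, mul_zero]
    rfl
  · rw [padicIncl_of_ne hu, zero_mul]
    rfl

theorem continuous_padicIncl (q : P) : Continuous (padicIncl q) := by
  refine continuous_of_continuousAt_zero (padicIncl q) ?_
  rw [ContinuousAt, map_zero]
  intro W hW
  obtain ⟨F, U, hU, h⟩ := exists_finset_of_mem_nhds_zero hW
  rw [Filter.mem_map]
  filter_upwards [hU q, (isOpen_padicInt ((q : Nat.Primes) : ℕ)).mem_nhds
    (zero_mem (PadicInt.subring ((q : Nat.Primes) : ℕ)))] with t ht ht'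
  refine h _ (padicIncl_mem_intAdele ht') fun r _ => ?_
  by_cases hr : r = q
  · subst hr
    rwa [padicIncl_same]
  · rw [padicIncl_of_ne hr]
    exact mem_of_mem_nhds (hU r)

/-- The partial sums of the idempotents converge to `1`: the remainder is integral and vanishes at
the primes of `F`. -/
theorem exists_finset_one_sub_sum_mem {W : Set (FinAdele P)} (hW : W ∈ 𝓝 (0 : FinAdele P)) :
    ∃ F : Finset P, 1 - ∑ q ∈ F, padicIncl q 1 ∈ W := by
  obtain ⟨F, U, hU, h⟩ := exists_finset_of_mem_nhds_zero hW
  refine ⟨F, h _ (sub_mem (one_mem _) (sum_mem fun q _ => padicIncl_mem_intAdele (one_mem _)))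
    fun r hr => ?_⟩
  have h1 : (1 - ∑ q ∈ F, padicIncl q 1) r = 0 := by
    have hs : (∑ q ∈ F, padicIncl q 1) r = ∑ q ∈ F, padicIncl q 1 r :=
      map_sum (RestrictedProduct.evalRingHom (fun q : P => ℚ_[((q : Nat.Primes) : ℕ)]) r) _ _
    rw [RestrictedProduct.sub_apply, hs, Finset.sum_eq_single_of_mem r hr fun q _ hq =>
      padicIncl_of_ne hq.symm 1, padicIncl_same, RestrictedProduct.one_apply, sub_self]
  rw [h1]
  exact mem_of_mem_nhds (hU r)

/-! ### The denominators -/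

theorem prime_pow_mem (q : P) (k : ℕ) : ((q : Nat.Primes) : ℕ) ^ k ∈ primeMonoid P := by
  refine pow_mem (Submonoid.subset_closure ?_) k
  exact ⟨(q : Nat.Primes), q.2, rfl⟩

theorem inv_mem_zLoc {s : ℕ} (hs : s ∈ primeMonoid P) : ((s : ℚ)⁻¹) ∈ ZLoc P := by
  refine ⟨1, s, ⟨s, hs, rfl⟩, ?_⟩
  simp

/-- The inverse of a denominator, as an element of `ℤ[S⁻¹]`. -/
def invDenom {s : ℕ} (hs : s ∈ primeMonoid P) : ZLoc P := ⟨(s : ℚ)⁻¹, inv_mem_zLoc hs⟩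

theorem natCast_mul_invDenom {s : ℕ} (hs : s ∈ primeMonoid P) : (s : ZLoc P) * invDenom hs = 1 := by
  refine Subtype.ext ?_
  have : (s : ℚ) ≠ 0 := by
    rintro h
    exact zero_notMem_primeMonoid P (by exact_mod_cast (Nat.cast_eq_zero.1 h) ▸ hs)
  exact mul_inv_cancel₀ this

/-- A product of high powers of the finitely many constrained primes contracts all integral adeles
at once, and it is invertible in `ℤ[S⁻¹]`. -/
theorem exists_natCast_mul_mem {W : Set (FinAdele P)} (hW : W ∈ 𝓝 (0 : FinAdele P)) :
    ∃ s ∈ primeMonoid P, ∀ a ∈ intAdele P, (s : FinAdele P) * a ∈ W := by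
  obtain ⟨F, U, hU, h⟩ := exists_finset_of_mem_nhds_zero hW
  have hk : ∀ q : P, ∃ k : ℕ, ∀ t ∈ PadicInt.subring ((q : Nat.Primes) : ℕ),
      (((q : Nat.Primes) : ℕ) : ℚ_[((q : Nat.Primes) : ℕ)]) ^ k * t ∈ U q := by
    intro q
    obtain ⟨ε, hε, hb⟩ := Metric.mem_nhds_iff.1 (hU q)
    have hq : ((((q : Nat.Primes) : ℕ) : ℝ)⁻¹) < 1 :=
      inv_lt_one_of_one_lt₀ (by exact_mod_cast (q : Nat.Primes).2.one_lt)
    obtain ⟨k, hk⟩ := exists_pow_lt_of_lt_one hε hq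
    refine ⟨k, fun t ht => hb ?_⟩
    rw [mem_ball_zero_iff, norm_mul, norm_pow, Padic.norm_p]
    exact (mul_le_of_le_one_right (by positivity) ht).trans_lt hk
  choose k hk using hk
  refine ⟨∏ q ∈ F, ((q : Nat.Primes) : ℕ) ^ k q, prod_mem fun q _ => prime_pow_mem q _,
    fun a ha => h _ (mul_mem (natCast_mem _ _) ha) fun r hr => ?_⟩
  obtain ⟨m, hm⟩ := Finset.dvd_prod_of_mem (fun q : P => ((q : Nat.Primes) : ℕ) ^ k q) hr
  have : (((∏ q ∈ F, ((q : Nat.Primes) : ℕ) ^ k q : ℕ) : FinAdele P) * a) r =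
      (((r : Nat.Primes) : ℕ) : ℚ_[((r : Nat.Primes) : ℕ)]) ^ k r * (m * a r) := by
    rw [hm, RestrictedProduct.mul_apply, ← mul_assoc]
    congr 1
    change (((_ * m : ℕ) : ℚ_[((r : Nat.Primes) : ℕ)])) = _
    push_cast
    rfl
  rw [this]
  exact hk r _ (mul_mem (natCast_mem _ _) (mem_intAdele.1 ha r))

/-! ### Compact open submodules -/

section CompactOpen

variable {P : Set Nat.Primes} {M : Type*} [AddCommGroup M] [TopologicalSpace M]
  [Module (FinAdele P) M] [ContinuousSMul (FinAdele P) M]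

theorem eventually_smul_mem {A : Type*} [CommRing A] [TopologicalSpace A] [Module A M]
    [ContinuousSMul A M] {K U : Set M} (hK : IsCompact K) (hU : U ∈ 𝓝 (0 : M)) :
    ∀ᶠ a in 𝓝 (0 : A), ∀ x ∈ K, a • x ∈ U := by
  refine hK.eventually_forall_of_forall_eventually fun x _ => ?_
  have h : ContinuousAt (fun z : A × M => z.1 • z.2) (0, x) := continuous_smul.continuousAt
  refine h ?_
  simpa using hU

theorem exists_natCast_mul_smul_mem {K U : Set M} (hK : IsCompact K) (hU : U ∈ 𝓝 (0 : M)) :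
    ∃ s ∈ primeMonoid P, ∀ a ∈ intAdele P, ∀ x ∈ K, ((s : FinAdele P) * a) • x ∈ U :=
  exists_natCast_mul_mem (eventually_smul_mem hK hU)

-- A compact neighbourhood `K` of `0` is first saturated to a compact set `C` stable under integral
-- adeles. `C` need not be closed under addition, but adding a suitable finitely generated submodule
-- `G` repairs this.
open Pointwise in
theorem exists_isCompact_isOpen_submodule (P : Set Nat.Primes) (M : Type*) [AddCommGroup M]
    [TopologicalSpace M] [Module (FinAdele P) M] [ContinuousSMul (FinAdele P) M]
    [IsTopologicalAddGroup M] [LocallyCompactSpace M] :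
    ∃ H : Submodule (intAdele P) M, IsCompact (H : Set M) ∧ IsOpen (H : Set M) := by
  have hcs : CompactSpace (intAdele P) := isCompact_iff_compactSpace.1 (isCompact_intAdele P)
  obtain ⟨K, hK, hK0⟩ := exists_compact_mem_nhds (0 : M)
  let C : Set M := (fun z : FinAdele P × M => z.1 • z.2) '' ((intAdele P : Set _) ×ˢ K)
  have hC : IsCompact C := ((isCompact_intAdele P).prod hK).image continuous_smul
  have hKC : K ⊆ C := fun x hx => ⟨(1, x), ⟨one_mem _, hx⟩, one_smul _ x⟩
  have hCsmul : ∀ a ∈ intAdele P, ∀ x ∈ C, a • x ∈ C := by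
    rintro a ha _ ⟨⟨b, x⟩, ⟨hb, hx⟩, rfl⟩
    exact ⟨(a * b, x), ⟨mul_mem ha hb, hx⟩, mul_smul a b x⟩
  obtain ⟨V, hV, hVV⟩ := exists_nhds_zero_half hK0
  obtain ⟨s, hs, hsV⟩ := exists_natCast_mul_smul_mem (P := P) hC hV
  let t : FinAdele P := toFinAdele P (invDenom hs)
  have hst : (s : FinAdele P) * t = 1 := by
    rw [← map_natCast (toFinAdele P), ← map_mul, natCast_mul_invDenom, map_one]
  -- Since `t` is inverse to `s`, this is `s • C`: a neighbourhood of `0` so small that `D + D ⊆ K`.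
  let D : Set M := (fun x => t • x) ⁻¹' C
  have hD : D ∈ 𝓝 (0 : M) := by
    refine (continuous_const_smul t).continuousAt ?_
    rw [smul_zero]
    exact Filter.mem_of_superset hK0 hKC
  have hDV : D ⊆ V := fun x hx => by
    have h := hsV 1 (one_mem _) _ hx
    rwa [mul_one, smul_smul, hst, one_smul] at h
  obtain ⟨T, -, hT⟩ := hC.elim_nhds_subcover (fun c => (fun x => x - c) ⁻¹' D) fun c _ => by
    refine (continuous_sub_right c).continuousAt ?_
    rwa [sub_self]
  let G : Submodule (intAdele P) M := Submodule.span _ (T : Set M)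
  -- Finitely generated over a compact ring.
  have hG : IsCompact (G : Set M) := Submodule.isCompact_of_fg ⟨T, rfl⟩
  have hCG : ∀ x ∈ C, ∃ g ∈ G, x - g ∈ D := fun x hx => by
    obtain ⟨c, hc, hxc⟩ := Set.mem_iUnion₂.1 (hT hx)
    exact ⟨c, Submodule.subset_span hc, hxc⟩
  have h0C : (0 : M) ∈ C := hKC (mem_of_mem_nhds hK0)
  -- Closed under addition because `C ⊆ G + D` and `D + D ⊆ K ⊆ C`.
  let H : Submodule (intAdele P) M :=
    { carrier := (G : Set M) + C
      zero_mem' := ⟨0, G.zero_mem, 0, h0C, add_zero 0⟩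
      add_mem' := by
        rintro _ _ ⟨g, hg, x, hx, rfl⟩ ⟨g', hg', x', hx', rfl⟩
        obtain ⟨h, hh, hxh⟩ := hCG x hx
        obtain ⟨h', hh', hxh'⟩ := hCG x' hx'
        refine ⟨g + g' + h + h', add_mem (add_mem (add_mem hg hg') hh) hh', (x - h) + (x' - h'),
          hKC (hVV _ (hDV hxh) _ (hDV hxh')), ?_⟩
        change g + g' + h + h' + (x - h + (x' - h')) = g + x + (g' + x')
        abel
      smul_mem' := by
        rintro a _ ⟨g, hg, x, hx, rfl⟩
        exact ⟨a • g, G.smul_mem a hg, (a : FinAdele P) • x, hCsmul a a.2 x hx,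
          (smul_add a g x).symm⟩ }
  refine ⟨H, hG.add hC, H.toAddSubgroup.isOpen_of_mem_nhds (g := 0) ?_⟩
  refine Filter.mem_of_superset hK0 fun x hx => ?_
  exact ⟨0, G.zero_mem, x, hKC hx, zero_add x⟩

end CompactOpen

/-! ### Lattices in finite dimensional `p`-adic vector spaces -/

section Lattice

variable {p : ℕ} [Fact p.Prime] {V : Type*} [AddCommGroup V] [TopologicalSpace V]
  [IsTopologicalAddGroup V] [T2Space V] [Module ℚ_[p] V] [ContinuousSMul ℚ_[p] V]

omit [IsTopologicalAddGroup V] [T2Space V] in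
theorem exists_pow_smul_mem {U : Set V} (hU : U ∈ 𝓝 (0 : V)) (x : V) :
    ∃ k : ℕ, (p : ℚ_[p]) ^ k • x ∈ U := by
  have h1 : Filter.Tendsto (fun k : ℕ => (p : ℚ_[p]) ^ k) Filter.atTop (𝓝 0) :=
    tendsto_pow_atTop_nhds_zero_of_norm_lt_one Padic.norm_p_lt_one
  have h2 := h1.smul_const x
  rw [zero_smul] at h2
  exact (h2.eventually hU).exists

/-- Compactness bounds the subgroup, so it sits in a finitely generated `ℤ_p`-module and is itself
finitely generated; being torsion free, it is free. Openness makes it absorbing, so a `ℤ_p`-basis of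
it is also a `ℚ_p`-basis of `V`. -/
theorem exists_equiv_lattice (H : AddSubgroup V) (hc : IsCompact (H : Set V))
    (ho : IsOpen (H : Set V)) (hs : ∀ t ∈ PadicInt.subring p, ∀ x ∈ H, t • x ∈ H) :
    ∃ e : V ≃L[ℚ_[p]] (Fin (Module.finrank ℚ_[p] V) → ℚ_[p]),
      ∀ x, x ∈ H ↔ e x ∈ padicLattice p (Module.finrank ℚ_[p] V) := by
  have : LocallyCompactSpace V :=
    hc.locallyCompactSpace_of_mem_nhds_of_addGroup (ho.mem_nhds H.zero_mem)
  have : FiniteDimensional ℚ_[p] V := .of_locallyCompactSpace ℚ_[p]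
  let _ : Module ℤ_[p] V := Module.compHom V (PadicInt.Coe.ringHom (p := p))
  have : IsScalarTower ℤ_[p] ℚ_[p] V := ⟨fun a b x => by
    rw [Algebra.smul_def, mul_smul]
    rfl⟩
  have hsm (a : ℤ_[p]) (x : V) : a • x = (a : ℚ_[p]) • x := rfl
  let N : Submodule ℤ_[p] V :=
    { H.toAddSubmonoid with smul_mem' := fun a x hx => hs a a.2 x hx }
  have hfg : N.FG := by
    let b := Module.finBasis ℚ_[p] V
    let e := b.equivFunL
    -- All coordinates on `H` are bounded by `p ^ k` in norm, which puts `H` inside `p ^ (-k)` times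
    -- the standard lattice.
    obtain ⟨r, hr⟩ := (hc.image e.continuous).isBounded.exists_norm_le
    obtain ⟨k, hk⟩ := pow_unbounded_of_one_lt r
      (show (1 : ℝ) < p by exact_mod_cast (Fact.out : p.Prime).one_lt)
    have hp0 : (p : ℚ_[p]) ≠ 0 := by exact_mod_cast (Fact.out : p.Prime).ne_zero
    let N' : Submodule ℤ_[p] V :=
      Submodule.span ℤ_[p] (Set.range fun i => ((p : ℚ_[p]) ^ k)⁻¹ • b i)
    have hN' : N'.FG := Submodule.fg_span (Set.finite_range _)
    have : IsNoetherian ℤ_[p] N' := isNoetherian_of_fg_of_noetherian N' hN'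
    refine Submodule.FG.of_le hN' fun x hx => ?_
    have hx' : ∀ i, ‖(p : ℚ_[p]) ^ k * e x i‖ ≤ 1 := fun i => by
      have h1 : ‖e x i‖ ≤ (p : ℝ) ^ k :=
        (norm_le_pi_norm (e x) i).trans ((hr _ ⟨x, hx, rfl⟩).trans hk.le)
      rw [norm_mul, norm_pow, Padic.norm_p, inv_pow]
      exact inv_mul_le_one_of_le₀ h1 (by positivity)
    let y : Fin (Module.finrank ℚ_[p] V) → ℤ_[p] := fun i => ⟨(p : ℚ_[p]) ^ k * e x i, hx' i⟩
    rw [← b.sum_equivFun x]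
    refine sum_mem fun i _ => ?_
    have h2 : b.equivFun x i • b i =
        y i • ((p : ℚ_[p]) ^ k)⁻¹ • b i := by
      rw [hsm, smul_smul]
      congr 1
      change e x i = ((p : ℚ_[p]) ^ k * e x i) * _
      field_simp
    rw [h2]
    exact N'.smul_mem _ (Submodule.subset_span ⟨i, rfl⟩)
  have : Module.Finite ℤ_[p] N := Module.Finite.iff_fg.2 hfg
  have : Module.IsTorsionFree ℤ_[p] V := .trans_faithfulSMul ℤ_[p] ℚ_[p] V
  have : Module.Free ℤ_[p] N := Module.free_of_finite_type_torsion_free'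
  let b := Module.finBasis ℤ_[p] N
  let v : Fin (Module.finrank ℤ_[p] N) → V := fun i => (b i : V)
  have hli : LinearIndependent ℚ_[p] v := by
    rw [← LinearIndependent.iff_fractionRing (R := ℤ_[p])]
    exact b.linearIndependent.map' N.subtype (Submodule.ker_subtype N)
  have hrepr : ∀ x : N, (x : V) = ∑ i, ((b.repr x i : ℤ_[p]) : ℚ_[p]) • v i := fun x => by
    conv_lhs => rw [← b.sum_repr x]
    rw [AddSubmonoidClass.coe_finsetSum]
    rfl
  have hsp : ⊤ ≤ Submodule.span ℚ_[p] (Set.range v) := fun x _ => by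
    obtain ⟨k, hk⟩ := exists_pow_smul_mem (p := p) (ho.mem_nhds H.zero_mem) x
    have hp0 : (p : ℚ_[p]) ^ k ≠ 0 := pow_ne_zero _ (by exact_mod_cast (Fact.out : p.Prime).ne_zero)
    have h1 : (p : ℚ_[p]) ^ k • x = _ := hrepr ⟨_, hk⟩
    rw [← Submodule.smul_mem_iff _ hp0, h1]
    exact sum_mem fun i _ => Submodule.smul_mem _ _ (Submodule.subset_span ⟨i, rfl⟩)
  let B := Module.Basis.mk hli hsp
  have hcard : Module.finrank ℤ_[p] N = Module.finrank ℚ_[p] V := by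
    rw [Module.finrank_eq_card_basis B, Fintype.card_fin]
  let B' := B.reindex (finCongr hcard)
  refine ⟨B'.equivFunL, fun x => ⟨fun hx i => ?_, fun hx => ?_⟩⟩
  · have h1 : B.equivFun x = fun i => ((b.repr ⟨x, hx⟩ i : ℤ_[p]) : ℚ_[p]) := by
      have h2 := hrepr ⟨x, hx⟩
      rw [← B.equivFun.symm.injective.eq_iff, LinearEquiv.symm_apply_apply, B.equivFun_symm_apply]
      simpa [B] using h2
    have h3 : B'.equivFunL x i = B.equivFun x ((finCongr hcard).symm i) := by
      simp [B']
    rw [h3, h1]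
    exact PadicInt.norm_le_one _
  · rw [← B'.sum_equivFun x]
    refine sum_mem fun i _ => hs _ (hx i) _ ?_
    have : B' i = v ((finCongr hcard).symm i) := by simp [B', B]
    rw [this]
    exact (b _).2

end Lattice

/-! ### Locally compact modules over the finite adele ring -/

theorem isOpen_padicLattice (p : ℕ) [Fact p.Prime] (k : ℕ) :
    IsOpen (padicLattice p k : Set (Fin k → ℚ_[p])) := by
  have h : (padicLattice p k : Set (Fin k → ℚ_[p])) =
      Set.univ.pi fun _ => (PadicInt.subring p : Set ℚ_[p]) := by
    ext x
    simp [padicLattice]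
  rw [h]
  exact isOpen_set_pi Set.finite_univ fun _ _ => isOpen_padicInt p

instance fact_isOpen_padicLattice (P : Set Nat.Primes) (d : P → ℕ) :
    Fact (∀ q : P, IsOpen (padicLattice ((q : Nat.Primes) : ℕ) (d q) :
      Set (Fin (d q) → ℚ_[((q : Nat.Primes) : ℕ)]))) :=
  ⟨fun _ => isOpen_padicLattice _ _⟩

/-! ### Recovering an element from its `q`-components -/

section Components

variable {P : Set Nat.Primes} {M : Type*} [AddCommGroup M] [TopologicalSpace M]
  [Module (FinAdele P) M] [ContinuousSMul (FinAdele P) M]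

theorem exists_finset_sub_sum_mem {U : Set M} (hU : U ∈ 𝓝 (0 : M)) (x : M) :
    ∃ F : Finset P, x - ∑ q ∈ F, padicIncl q 1 • x ∈ U := by
  obtain ⟨F, hF⟩ := exists_finset_one_sub_sum_mem
    (eventually_smul_mem (A := FinAdele P) (isCompact_singleton (x := x)) hU)
  refine ⟨F, ?_⟩
  have h := hF x rfl
  rwa [sub_smul, one_smul, Finset.sum_smul] at h

theorem eq_zero_of_forall_padicIncl_smul [T2Space M] {x : M}
    (hx : ∀ q : P, padicIncl q 1 • x = 0) : x = 0 := by
  by_contra hne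
  obtain ⟨F, hF⟩ := exists_finset_sub_sum_mem (P := P)
    (isOpen_compl_singleton.mem_nhds (show (0 : M) ∈ {x}ᶜ from fun h => hne h.symm)) x
  refine hF ?_
  rw [Finset.sum_eq_zero fun q _ => hx q, sub_zero]
  rfl

/-- An open `H` contains the tail left after subtracting finitely many components. -/
theorem mem_iff_forall_padicIncl_smul_mem {H : Submodule (intAdele P) M}
    (ho : IsOpen (H : Set M)) {x : M} : x ∈ H ↔ ∀ q : P, padicIncl q 1 • x ∈ H := by
  refine ⟨fun hx q => H.smul_mem (⟨_, padicIncl_mem_intAdele (one_mem _)⟩ : intAdele P) hx,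
    fun hx => ?_⟩
  obtain ⟨F, hF⟩ := exists_finset_sub_sum_mem (P := P) (ho.mem_nhds H.zero_mem) x
  rw [← sub_add_cancel x (∑ q ∈ F, padicIncl q 1 • x)]
  exact add_mem hF (sum_mem fun q _ => hx q)

/-- Some denominator `s` moves `x` into `H`; for almost all `q` the number `1 / s` is `q`-integral,
so the `q`-component can be divided by `s` without leaving `H`. -/
theorem eventually_padicIncl_smul_mem {H : Submodule (intAdele P) M}
    (ho : IsOpen (H : Set M)) (x : M) :
    ∀ᶠ q : P in Filter.cofinite, padicIncl q 1 • x ∈ H := by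
  obtain ⟨s, hs, h⟩ := exists_natCast_mul_smul_mem (P := P) (isCompact_singleton (x := x))
    (ho.mem_nhds H.zero_mem)
  have hx : (s : FinAdele P) • x ∈ H := by simpa using h 1 (one_mem _) x rfl
  filter_upwards [eventually_norm_le_one P (invDenom hs : ℚ)] with q hq
  have h1 := H.smul_mem (⟨padicIncl q _, padicIncl_mem_intAdele hq⟩ : intAdele P) hx
  change padicIncl q _ • (s : FinAdele P) • x ∈ H at h1
  rw [smul_smul] at h1
  convert h1 using 2
  have h2 : (toFinAdele P (invDenom hs)) * (s : FinAdele P) = 1 := by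
    rw [← map_natCast (toFinAdele P), ← map_mul, mul_comm, natCast_mul_invDenom, map_one]
  change _ = padicIncl q (toFinAdele P (invDenom hs) q) * _
  rw [← padicIncl_one_mul, mul_assoc, h2, mul_one]

end Components

/-! ### Gluing the `q`-components into a restricted product -/

section Classification

variable (P : Set Nat.Primes) (M : Type*) [AddCommGroup M] [TopologicalSpace M]
  [IsTopologicalAddGroup M] [T2Space M] [LocallyCompactSpace M]
  [Module (FinAdele P) M] [ContinuousSMul (FinAdele P) M]

/-- The dimension of the `q`-component of a module over the finite adele ring. -/
def padicDim (q : P) : ℕ := Module.finrank ℚ_[((q : Nat.Primes) : ℕ)] (Corner (padicIncl q) M)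

/-- One submodule `H` normalizes the coordinates at all primes simultaneously. Membership in `H` is
then integrality of every coordinate, which is what matches the algebra and the topology with those
of the restricted product. -/
theorem exists_padicPowers_equiv : ∃ Ψ : M ≃ₜ+ PadicPowers P (padicDim P M),
    ∀ (a : FinAdele P) (x : M) (q : P) (i : Fin (padicDim P M q)),
      Ψ (a • x) q i = a q * Ψ x q i := by
  obtain ⟨H, hc, ho⟩ := exists_isCompact_isOpen_submodule P M
  have hsmul (q : P) := corner_continuousSMul (M := M) (padicIncl q) (continuous_padicIncl q)
  have hloc (q : P) := exists_equiv_lattice (V := Corner (padicIncl q) M)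
    (H.toAddSubgroup.comap (Corner (padicIncl q) M).subtype.toAddMonoidHom)
    ((isClosed_corner (padicIncl q)).isClosedEmbedding_subtypeVal.isCompact_preimage hc)
    (ho.preimage continuous_subtype_val)
    (fun t ht x hx => H.smul_mem (⟨padicIncl q t, padicIncl_mem_intAdele ht⟩ : intAdele P) hx)
  obtain ⟨c, hcl⟩ : ∃ c : ∀ q : P, Corner (padicIncl q) M ≃L[ℚ_[((q : Nat.Primes) : ℕ)]]
      (Fin (padicDim P M q) → ℚ_[((q : Nat.Primes) : ℕ)]),
      ∀ (q : P) (x : Corner (padicIncl q) M), (x : M) ∈ H ↔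
        c q x ∈ padicLattice ((q : Nat.Primes) : ℕ) (padicDim P M q) :=
    ⟨fun q => (hloc q).choose, fun q => (hloc q).choose_spec⟩
  let f : M →+ PadicPowers P (padicDim P M) :=
    { toFun := fun x => ⟨fun q => c q (cornerProj (padicIncl q) x), by
        filter_upwards [eventually_padicIncl_smul_mem ho x] with q hq
        exact (hcl q _).1 hq⟩
      map_zero' := by
        ext q i
        change c q (cornerProj (padicIncl q) 0) i = 0
        rw [map_zero, map_zero]
        rfl
      map_add' := fun x y => by
        ext q i
        change c q (cornerProj (padicIncl q) (x + y)) i =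
          c q (cornerProj (padicIncl q) x) i + c q (cornerProj (padicIncl q) y) i
        rw [map_add, map_add]
        rfl }
  have hf (x : M) (q : P) : f x q = c q (cornerProj (padicIncl q) x) := rfl
  have hfH (x : M) : x ∈ H ↔ ∀ q : P, f x q ∈ padicLattice ((q : Nat.Primes) : ℕ) _ := by
    rw [mem_iff_forall_padicIncl_smul_mem ho]
    exact forall_congr' fun q => hcl q (cornerProj (padicIncl q) x)
  have hcont (q : P) : Continuous fun x => f x q :=
    (c q).continuous.comp (continuous_cornerProj (padicIncl q))
  have hinj : Function.Injective f := by
    rw [injective_iff_map_eq_zero]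
    intro x hx
    refine eq_zero_of_forall_padicIncl_smul (P := P) fun q => ?_
    have h1 : c q (cornerProj (padicIncl q) x) = 0 := by
      rw [← hf, hx]
      rfl
    rw [← coe_cornerProj, (map_eq_zero_iff _ (c q).injective).1 h1]
    rfl
  have hsymm_same (q : P) (v) : f ((c q).symm v : M) q = v := by
    rw [hf, cornerProj_coe, ContinuousLinearEquiv.apply_symm_apply]
  have hsymm_ne {q r : P} (h : r ≠ q) (v) : f ((c q).symm v : M) r = 0 := by
    have h1 : cornerProj (padicIncl r) ((c q).symm v : M) = 0 := by
      refine Subtype.ext ?_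
      rw [coe_cornerProj, ← (mem_corner (padicIncl q)).1 ((c q).symm v).2, smul_smul,
        padicIncl_mul_of_ne h, zero_smul]
      rfl
    rw [hf, h1]
    exact map_zero (c r)
  have heval (F : Finset P) (g : P → M) (q : P) : f (∑ r ∈ F, g r) q = ∑ r ∈ F, f (g r) q :=
    map_sum ((RestrictedProduct.evalAddMonoidHom _ q).comp f) _ _
  have hsum (F : Finset P) (y : ∀ q : P, Fin (padicDim P M q) → ℚ_[((q : Nat.Primes) : ℕ)])
      (q : P) (hq : q ∈ F) : f (∑ r ∈ F, ((c r).symm (y r) : M)) q = y q := by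
    rw [heval, Finset.sum_eq_single_of_mem q hq fun r _ hr => hsymm_ne hr.symm _, hsymm_same]
  have hsurjH (y : ∀ q : P, Fin (padicDim P M q) → ℚ_[((q : Nat.Primes) : ℕ)])
      (hy : ∀ q : P, y q ∈ padicLattice ((q : Nat.Primes) : ℕ) _) :
      ∃ x ∈ H, ∀ q, f x q = y q := by
    -- The finite partial sums stay in the compact `H`, so they converge along an ultrafilter
    -- refining `atTop`; each coordinate is eventually constant there.
    let u : Ultrafilter (Finset P) := Ultrafilter.of Filter.atTop
    let X : Finset P → M := fun F => ∑ r ∈ F, ((c r).symm (y r) : M)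
    have hX (F : Finset P) : X F ∈ H := sum_mem fun r _ =>
      (hcl r _).2 (by rw [ContinuousLinearEquiv.apply_symm_apply]; exact hy r)
    obtain ⟨x, hx, hux⟩ := hc.ultrafilter_le_nhds (u.map X)
      (Filter.le_principal_iff.2 (Filter.Eventually.of_forall (f := (u : Filter (Finset P))) hX))
    refine ⟨x, hx, fun q => ?_⟩
    have h1 : Filter.Tendsto (fun F => f (X F) q) u (𝓝 (f x q)) :=
      ((hcont q).tendsto x).comp hux
    have h2 : ∀ᶠ F in (u : Filter (Finset P)), f (X F) q = y q := by
      refine Ultrafilter.of_le Filter.atTop ?_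
      filter_upwards [Filter.eventually_ge_atTop ({q} : Finset P)] with F hF
      exact hsum F y q (hF (Finset.mem_singleton_self q))
    exact tendsto_nhds_unique h1 (tendsto_const_nhds.congr' (h2.mono fun _ h => h.symm))
  have hsurj : Function.Surjective f := by
    classical
    intro y
    let F : Finset P := (Filter.eventually_cofinite.1 y.eventually).toFinset
    have hF (q : P) (hq : q ∉ F) : y q ∈ padicLattice ((q : Nat.Primes) : ℕ) _ := by
      by_contra h
      exact hq (by simpa [F] using h)
    -- The integral coordinates come from `H`; the finitely many others are added as a finite sum.
    obtain ⟨x, -, hx⟩ := hsurjH (fun q : P => if q ∈ F then 0 else y q) fun q => by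
      split_ifs with h
      · exact zero_mem _
      · exact hF q h
    refine ⟨x + ∑ r ∈ F, ((c r).symm (y r) : M), ?_⟩
    ext1 q
    rw [map_add, RestrictedProduct.add_apply, hx]
    by_cases h : q ∈ F
    · rw [hsum F _ q h, if_pos h, zero_add]
    · rw [if_neg h, heval, Finset.sum_eq_zero fun r hr => hsymm_ne (fun h' : q = r => h (h' ▸ hr)) _,
        add_zero]
  -- A continuous bijection from the compact `H` to the Hausdorff product of lattices is a
  -- homeomorphism. Both sides are open neighbourhoods of `0`, so this fixes the topology globally.
  have hmap : Filter.map f (𝓝 0) = 𝓝 0 := by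
    let g : H → ∀ q : P, padicLattice ((q : Nat.Primes) : ℕ) (padicDim P M q) :=
      fun x q => ⟨f x q, (hfH x).1 x.2 q⟩
    have hg : Continuous g := continuous_pi fun q =>
      ((hcont q).comp continuous_subtype_val).subtype_mk _
    have hgb : Function.Bijective g := by
      refine ⟨fun x y h => Subtype.ext (hinj ?_), fun y => ?_⟩
      · ext1 q
        exact congrArg Subtype.val (congrFun h q)
      · obtain ⟨x, hx, hxy⟩ := hsurjH (fun q : P => y q) fun q => (y q).2
        exact ⟨⟨x, hx⟩, funext fun q => Subtype.ext (hxy q)⟩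
    have hH0 : Filter.map Subtype.val (𝓝 (0 : H)) = 𝓝 (0 : M) :=
      ho.isOpenEmbedding_subtypeVal.map_nhds_eq (0 : H)
    have : CompactSpace H := isCompact_iff_compactSpace.1 hc
    let G := hg.homeoOfEquivCompactToT2 (f := Equiv.ofBijective g hgb)
    have hG : Filter.map g (𝓝 0) = 𝓝 0 := by
      have h0 : G 0 = 0 := by
        refine funext fun q => Subtype.ext ?_
        change f 0 q = 0
        rw [map_zero]
        rfl
      have := G.map_nhds_eq 0
      rwa [h0] at this
    have h0 := RestrictedProduct.nhds_zero_eq_map_structureMap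
      (R := fun q : P => Fin (padicDim P M q) → ℚ_[((q : Nat.Primes) : ℕ)])
      (B := fun q : P => padicLattice ((q : Nat.Primes) : ℕ) (padicDim P M q))
      (fun _ => isOpen_padicLattice _ _)
    rw [← hH0, Filter.map_map]
    refine Eq.trans ?_ h0.symm
    rw [← hG, Filter.map_map]
    rfl
  have hfc : Continuous f := continuous_of_continuousAt_zero f
    (by rw [ContinuousAt, map_zero]; exact hmap.le)
  let E : M ≃+ PadicPowers P (padicDim P M) := AddEquiv.ofBijective f ⟨hinj, hsurj⟩
  have hEc : Continuous E.symm := by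
    refine continuous_of_continuousAt_zero E.symm ?_
    rw [ContinuousAt, map_zero, ← hmap, Filter.tendsto_map'_iff]
    refine Filter.tendsto_id.congr fun x => ?_
    exact (E.symm_apply_apply x).symm
  refine ⟨{ E with continuous_toFun := hfc, continuous_invFun := hEc }, fun a x q i => ?_⟩
  change c q (cornerProj (padicIncl q) (a • x)) i = a q * c q (cornerProj (padicIncl q) x) i
  rw [cornerProj_smul _ _ _ (padicIncl_one_mul q a), map_smul]
  rfl

end Classification

/-! ### Characters -/

section Char

variable {M : Type*} [AddCommGroup M] [TopologicalSpace M]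

/-- The value of a character. -/
def charEval (χ : CharDual M) (x : M) : Circle := χ.toMul (Multiplicative.ofAdd x)

theorem charDual_ext {χ ψ : CharDual M} (h : ∀ x, charEval χ x = charEval ψ x) : χ = ψ :=
  Additive.toMul.injective (PontryaginDual.ext fun x => h x.toAdd)

theorem charEval_add (χ : CharDual M) (x y : M) :
    charEval χ (x + y) = charEval χ x * charEval χ y :=
  map_mul χ.toMul (Multiplicative.ofAdd x) (Multiplicative.ofAdd y)

theorem charEval_zero (χ : CharDual M) : charEval χ 0 = 1 := map_one χ.toMul

theorem charEval_nsmul (χ : CharDual M) (n : ℕ) (x : M) :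
    charEval χ (n • x) = charEval χ x ^ n :=
  map_pow χ.toMul (Multiplicative.ofAdd x) n

theorem charEval_sum (χ : CharDual M) {ι : Type*} (s : Finset ι) (f : ι → M) :
    charEval χ (∑ i ∈ s, f i) = ∏ i ∈ s, charEval χ (f i) :=
  map_prod χ.toMul (fun i => Multiplicative.ofAdd (f i)) s

theorem zero_charEval (x : M) : charEval (0 : CharDual M) x = 1 := rfl

theorem continuous_charEval (χ : CharDual M) : Continuous (charEval χ) :=
  (map_continuous χ.toMul).comp continuous_ofAdd

theorem smul_charEval {R : Type*} [CommRing R] [Module R M] [ContinuousConstSMul R M] (r : R)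
    (χ : CharDual M) (x : M) : charEval (r • χ) x = charEval χ (r • x) := rfl

/-- A character given by a continuous homomorphism. -/
def mkChar (f : M → Circle) (h0 : f 0 = 1) (hadd : ∀ x y, f (x + y) = f x * f y)
    (hf : Continuous f) : CharDual M :=
  Additive.ofMul (⟨⟨⟨fun x => f x.toAdd, h0⟩, fun x y => hadd x.toAdd y.toAdd⟩,
    hf.comp continuous_toAdd⟩ : Multiplicative M →ₜ* Circle)

@[simp]
theorem charEval_mkChar (f : M → Circle) (h0 : f 0 = 1) (hadd : ∀ x y, f (x + y) = f x * f y)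
    (hf : Continuous f) (x : M) : charEval (mkChar f h0 hadd hf) x = f x := rfl

instance [LocallyCompactSpace M] : LocallyCompactSpace (Multiplicative M) :=
  inferInstanceAs (LocallyCompactSpace M)

instance charDual_locallyCompactSpace [IsTopologicalAddGroup M] [LocallyCompactSpace M] :
    LocallyCompactSpace (CharDual M) :=
  inferInstanceAs (LocallyCompactSpace (PontryaginDual (Multiplicative M)))

instance charDual_t2Space : T2Space (CharDual M) :=
  inferInstanceAs (T2Space (PontryaginDual (Multiplicative M)))

/-- This lets the classification be applied to the dual. Local compactness of `M` makes evaluation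
jointly continuous, and currying returns to the compact-open topology. -/
instance charDual_continuousSMul {A : Type*} [CommRing A] [TopologicalSpace A]
    [LocallyCompactSpace M] [Module A M] [ContinuousSMul A M] : ContinuousSMul A (CharDual M) where
  continuous_smul := by
    have h : Continuous (fun z : (A × CharDual M) × Multiplicative M =>
        (z.1.2.toMul : Multiplicative M →ₜ* Circle)
          (Multiplicative.ofAdd (z.1.1 • z.2.toAdd))) := by
      refine Continuous.eval (F := Multiplicative M →ₜ* Circle) ?_ ?_
      · exact continuous_toMul.comp (continuous_snd.comp continuous_fst)
      · exact continuous_ofAdd.comp ((continuous_fst.comp continuous_fst).smul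
          (continuous_toAdd.comp continuous_snd))
    exact continuous_ofMul.comp (ContinuousMonoidHom.continuous_of_continuous_uncurry
      (fun z : A × CharDual M => (z.1 • z.2).toMul) h)

/-- A corner of the dual is the dual of the corner. -/
def cornerDual {F A : Type*} [CommRing F] [CommRing A] [Module A M] [ContinuousConstSMul A M]
    (e : F →ₙ+* A) [ContinuousConstSMul F (Corner e M)] :
    Corner e (CharDual M) ≃ₗ[F] CharDual (Corner e M) where
  toFun χ := mkChar (fun x => charEval χ.1 x) (charEval_zero _) (fun _ _ => charEval_add _ _ _)
    ((continuous_charEval _).comp continuous_subtype_val)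
  map_add' _ _ := rfl
  map_smul' _ _ := rfl
  invFun χ := ⟨mkChar (fun x => charEval χ (cornerProj e x)) (by rw [map_zero, charEval_zero])
    (fun _ _ => by rw [map_add, charEval_add])
    ((continuous_charEval _).comp (continuous_cornerProj e)), by
      refine charDual_ext fun x => ?_
      rw [smul_charEval, charEval_mkChar, charEval_mkChar]
      congr 1
      exact cornerProj_coe e (cornerProj e x)⟩
  left_inv χ := Subtype.ext (charDual_ext fun x => by
    have h := congrArg (fun ψ => charEval ψ x) χ.2
    exact h)
  right_inv χ := charDual_ext fun x => by
    rw [charEval_mkChar, charEval_mkChar, cornerProj_coe]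

/-- All characters of the ring are multiples of a single non-trivial one. -/
def HasGeneratingChar (F : Type*) [CommRing F] [TopologicalSpace F] [ContinuousConstSMul F F] :
    Prop :=
  ∃ ψ : CharDual F, ψ ≠ 0 ∧ ∀ χ : CharDual F, ∃ a : F, χ = a • ψ

/-- Composition with the generating character `ψ` identifies the linear dual with the character
dual. It is injective because a nonzero functional is onto and `ψ` is nontrivial, and surjective by
treating each basis line separately. -/
theorem finrank_charDual {F : Type*} [NontriviallyNormedField F] [CompleteSpace F]
    (hF : HasGeneratingChar F) (V : Type*) [AddCommGroup V] [TopologicalSpace V] [T2Space V]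
    [IsTopologicalAddGroup V] [Module F V] [ContinuousSMul F V] [FiniteDimensional F V] :
    Module.finrank F (CharDual V) = Module.finrank F V := by
  obtain ⟨ψ, hψ, hgen⟩ := hF
  let T : Module.Dual F V →ₗ[F] CharDual V :=
    { toFun := fun f => mkChar (fun x => charEval ψ (f x)) (by rw [map_zero, charEval_zero])
        (fun _ _ => by rw [map_add, charEval_add])
        ((continuous_charEval ψ).comp f.continuous_of_finiteDimensional)
      map_add' := fun f g => charDual_ext fun x => charEval_add ψ (f x) (g x)
      map_smul' := fun a f => charDual_ext fun x => by
        rw [RingHom.id_apply, smul_charEval, charEval_mkChar, charEval_mkChar, map_smul]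
        rfl }
  have hT (f : Module.Dual F V) (x : V) : charEval (T f) x = charEval ψ (f x) := rfl
  have hinj : Function.Injective T := by
    rw [injective_iff_map_eq_zero]
    intro f hf
    by_contra hne
    refine hψ (charDual_ext fun t => ?_)
    obtain ⟨x, rfl⟩ := LinearMap.surjective hne t
    rw [← hT, hf]
    rfl
  have hsurj : Function.Surjective T := by
    intro χ
    let b := Module.finBasis F V
    have h (i) : ∃ a : F, ∀ t : F, charEval χ (t • b i) = charEval ψ (a * t) := by
      obtain ⟨a, ha⟩ := hgen (mkChar (fun t : F => charEval χ (t • b i))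
        (by rw [zero_smul, charEval_zero]) (fun _ _ => by rw [add_smul, charEval_add])
        ((continuous_charEval χ).comp (continuous_id.smul continuous_const)))
      refine ⟨a, fun t => ?_⟩
      have := congrArg (fun φ => charEval φ t) ha
      exact this
    choose a ha using h
    refine ⟨b.constr F a, charDual_ext fun x => ?_⟩
    rw [hT]
    conv_rhs => rw [← b.sum_equivFun x]
    rw [charEval_sum, b.constr_apply_fintype F, charEval_sum]
    refine Finset.prod_congr rfl fun i _ => ?_
    rw [ha, smul_eq_mul, mul_comm]
  rw [← (LinearEquiv.ofBijective T ⟨hinj, hsurj⟩).finrank_eq, Subspace.dual_finrank_eq]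

end Char

/-- A character lifts through the covering `Circle.exp` to a real function vanishing at `0`.
Uniqueness of lifts makes it additive, and continuity then makes it linear. -/
theorem hasGeneratingChar_real : HasGeneratingChar ℝ := by
  refine ⟨mkChar (fun x => Circle.exp x) Circle.exp_zero Circle.exp_add Circle.exp.continuous,
    fun h => ?_, fun χ => ?_⟩
  · have h1 := congrArg (fun φ => charEval φ Real.pi) h
    change Circle.exp Real.pi = 1 at h1
    have h2 := congrArg (fun z : Circle => (z : ℂ)) h1
    simp at h2
    norm_num at h2
  · obtain ⟨g, ⟨hg0, hg⟩, -⟩ := Circle.isCoveringMap_exp.existsUnique_continuousMap_lifts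
      ⟨charEval χ, continuous_charEval χ⟩ (0 : ℝ) (0 : ℝ)
      (by rw [Circle.exp_zero]; exact (charEval_zero χ).symm)
    have hg' (x : ℝ) : Circle.exp (g x) = charEval χ x := congrFun hg x
    have hadd (x y : ℝ) : g (x + y) = g x + g y := by
      have huniq := Circle.isCoveringMap_exp.existsUnique_continuousMap_lifts
        ⟨fun t => charEval χ (x + t), (continuous_charEval χ).comp (continuous_const_add x)⟩
        (0 : ℝ) (g x) (by rw [hg']; simp)
      have h1 := huniq.unique (y₁ := ⟨fun t => g (x + t), by fun_prop⟩)
        (y₂ := ⟨fun t => g x + g t, by fun_prop⟩) ⟨by simp, funext fun t => hg' (x + t)⟩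
        ⟨by simp [hg0], funext fun t => by
          simp only [Function.comp_apply, ContinuousMap.coe_mk]
          rw [Circle.exp_add, hg', hg', charEval_add]⟩
      exact congrArg (fun φ : C(ℝ, ℝ) => φ y) h1
    let G : ℝ →+ ℝ := ⟨⟨g, hg0⟩, hadd⟩
    refine ⟨g 1, charDual_ext fun x => ?_⟩
    rw [smul_charEval, charEval_mkChar, ← hg']
    congr 1
    have := map_real_smul G g.continuous x 1
    rw [smul_eq_mul, mul_one, smul_eq_mul] at this
    rw [smul_eq_mul, mul_comm]
    exact this

/-! ### The generating character of `ℚ_p` -/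

section PadicChar

variable (p : ℕ) [Fact p.Prime]

/-- The map `r ↦ exp (2πir)` on `ℚ` has kernel exactly `ℤ`; it converts `ℚ/ℤ`-valued characters into
circle-valued ones. -/
theorem exists_addCircle_char {a : AddCircle (1 : ℚ)} (ha : a ≠ 0) :
    ∃ f : AddCircle (1 : ℚ) →+ Additive Circle, f a ≠ 0 := by
  let h : ℚ →+ Additive Circle :=
    { toFun := fun r => Additive.ofMul (Circle.exp (r * (2 * Real.pi)))
      map_zero' := by simp
      map_add' := fun r s => by
        rw [← ofMul_mul, ← Circle.exp_add]
        push_cast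
        rw [add_mul] }
  have hker (r : ℚ) : h r = 0 ↔ ∃ n : ℤ, r = n := by
    change Additive.ofMul (Circle.exp (r * (2 * Real.pi))) = Additive.ofMul 1 ↔ _
    rw [Additive.ofMul.injective.eq_iff, Circle.exp_eq_one]
    refine exists_congr fun n => ?_
    rw [mul_left_inj' (by positivity)]
    exact_mod_cast Iff.rfl
  refine ⟨QuotientAddGroup.lift _ h fun r hr => ?_, ?_⟩
  · obtain ⟨n, rfl⟩ := AddSubgroup.mem_zmultiples_iff.1 hr
    exact (hker _).2 ⟨n, by simp⟩
  · induction a using QuotientAddGroup.induction_on with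
    | H r =>
      rw [QuotientAddGroup.lift_mk]
      intro h0
      obtain ⟨n, rfl⟩ := (hker r).1 h0
      exact ha ((AddCircle.coe_eq_zero_iff _).2 ⟨n, by simp⟩)

/-- Characters with values in `ℚ/ℤ` separate points of the discrete group `ℚ_p / ℤ_p`. Continuity is
automatic, since the pullback is trivial on the open subgroup `ℤ_p`. -/
theorem exists_padic_char : ∃ ψ : CharDual ℚ_[p],
    (∀ t ∈ PadicInt.subring p, charEval ψ t = 1) ∧ charEval ψ ((p : ℚ_[p])⁻¹) ≠ 1 := by
  let Z : AddSubgroup ℚ_[p] := (PadicInt.subring p).toAddSubgroup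
  have hp : 1 < (p : ℝ) := by exact_mod_cast (Fact.out : p.Prime).one_lt
  have hne : (QuotientAddGroup.mk (p : ℚ_[p])⁻¹ : ℚ_[p] ⧸ Z) ≠ 0 := by
    rw [Ne, QuotientAddGroup.eq_zero_iff]
    intro h
    have h1 : ‖((p : ℚ_[p])⁻¹)‖ ≤ 1 := h
    rw [norm_inv, Padic.norm_p, inv_inv] at h1
    exact absurd hp h1.not_gt
  obtain ⟨c, hc⟩ := CharacterModule.exists_character_apply_ne_zero_of_ne_zero hne
  obtain ⟨f, hf⟩ := exists_addCircle_char hc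
  let g : ℚ_[p] →+ Additive Circle := f.comp (AddMonoidHom.comp c (QuotientAddGroup.mk' Z))
  have hg : ∀ t ∈ PadicInt.subring p, g t = 0 := fun t ht => by
    have h1 : QuotientAddGroup.mk' Z t = 0 := (QuotientAddGroup.eq_zero_iff t).2 ht
    change f (c (QuotientAddGroup.mk' Z t)) = 0
    rw [h1]
    exact (congrArg f (map_zero c)).trans (map_zero f)
  have hcont : Continuous g := by
    refine continuous_of_continuousAt_zero g ?_
    refine (continuousAt_const (y := (0 : Additive Circle))).congr ?_
    filter_upwards [(isOpen_padicInt p).mem_nhds (zero_mem (PadicInt.subring p))] with t ht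
    exact (hg t ht).symm
  exact ⟨mkChar (fun t => (g t).toMul) (congrArg Additive.toMul (map_zero g))
    (fun x y => congrArg Additive.toMul (map_add g x y)) (continuous_toMul.comp hcont),
    fun t ht => congrArg Additive.toMul (hg t ht), fun h => hf (Additive.toMul.injective h)⟩

variable {p}

/-- The circle has no small subgroups: an element whose powers all stay in the open right half is
`1`. -/
theorem charEval_eq_one_of_pow_mem {M : Type*} [AddCommGroup M] [TopologicalSpace M]
    (χ : CharDual M) : ∃ U ∈ 𝓝 (0 : M), ∀ N : AddSubgroup M, (N : Set M) ⊆ U →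
      ∀ x ∈ N, charEval χ x = 1 := by
  refine ⟨charEval χ ⁻¹' Circle.centeredArc (Real.pi / 2), ?_, fun N hN x hx => ?_⟩
  · refine (continuous_charEval χ).continuousAt ((Circle.isOpen_centeredArc _).mem_nhds ?_)
    rw [charEval_zero, Circle.mem_centeredArc (by linarith [Real.pi_pos])]
    simp [Real.pi_pos]
  · refine Circle.eq_one_of_forall_pow_mem_centeredArc_pi_div_two fun n _ => ?_
    rw [← charEval_nsmul]
    exact hN (nsmul_mem hx n)

theorem exists_pow_smul_char_trivial (χ : CharDual ℚ_[p]) :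
    ∃ k : ℕ, ∀ t ∈ PadicInt.subring p, charEval ((p : ℚ_[p]) ^ k • χ) t = 1 := by
  obtain ⟨U, hU, h⟩ := charEval_eq_one_of_pow_mem χ
  have h1 : Filter.Tendsto (fun k : ℕ => (p : ℚ_[p]) ^ k) Filter.atTop (𝓝 0) :=
    tendsto_pow_atTop_nhds_zero_of_norm_lt_one Padic.norm_p_lt_one
  obtain ⟨k, hk⟩ := (h1.eventually (eventually_smul_mem (isCompact_padicInt p) hU)).exists
  refine ⟨k, fun t ht => ?_⟩
  refine h ((PadicInt.subring p).toAddSubgroup.map (AddMonoidHom.mulLeft ((p : ℚ_[p]) ^ k))) ?_ _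
    ⟨t, ht, rfl⟩
  rintro _ ⟨s, hs, rfl⟩
  exact hk s hs

/-- Nontriviality at `1 / p` gives `ψ (p ^ (-k))` exact order `p ^ k`, so its powers exhaust the `p
^ k`-th roots of unity, among which is `χ (p ^ (-k))`. -/
theorem exists_natCast_mul_charEval {ψ χ : CharDual ℚ_[p]}
    (hψ : ∀ t ∈ PadicInt.subring p, charEval ψ t = 1) (hψ' : charEval ψ ((p : ℚ_[p])⁻¹) ≠ 1)
    (hχ : ∀ t ∈ PadicInt.subring p, charEval χ t = 1) (k : ℕ) :
    ∃ m : ℕ, charEval χ ((p : ℚ_[p]) ^ k)⁻¹ = charEval ψ (m * ((p : ℚ_[p]) ^ k)⁻¹) := by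
  have hp0 : (p : ℚ_[p]) ≠ 0 := by exact_mod_cast (Fact.out : p.Prime).ne_zero
  have hpow (φ : CharDual ℚ_[p]) (hφ : ∀ t ∈ PadicInt.subring p, charEval φ t = 1) (k : ℕ) :
      charEval φ ((p : ℚ_[p]) ^ k)⁻¹ ^ p ^ k = 1 := by
    rw [← charEval_nsmul, nsmul_eq_mul, Nat.cast_pow, mul_inv_cancel₀ (pow_ne_zero _ hp0)]
    exact hφ 1 (one_mem _)
  rcases k with _ | k
  · exact ⟨1, by rw [hχ _ (by simp), hψ _ (by simp)]⟩
  have hord : orderOf (charEval ψ ((p : ℚ_[p]) ^ (k + 1))⁻¹) = p ^ (k + 1) := by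
    refine orderOf_eq_prime_pow ?_ (hpow ψ hψ _)
    rw [← charEval_nsmul, nsmul_eq_mul, Nat.cast_pow, pow_succ, mul_inv,
      mul_inv_cancel_left₀ (pow_ne_zero _ hp0)]
    exact hψ'
  have hprim : IsPrimitiveRoot ((charEval ψ ((p : ℚ_[p]) ^ (k + 1))⁻¹ : Circle) : ℂ)
      (p ^ (k + 1)) := by
    have := IsPrimitiveRoot.orderOf (charEval ψ ((p : ℚ_[p]) ^ (k + 1))⁻¹)
    rw [hord] at this
    exact this.map_of_injective (f := Circle.coeHom) Circle.coe_injective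
  have : NeZero (p ^ (k + 1)) := ⟨pow_ne_zero _ (Fact.out : p.Prime).ne_zero⟩
  obtain ⟨m, -, hm⟩ := hprim.eq_pow_of_pow_eq_one
    (show ((charEval χ ((p : ℚ_[p]) ^ (k + 1))⁻¹ : Circle) : ℂ) ^ p ^ (k + 1) = 1 by
      exact_mod_cast congrArg (fun z : Circle => (z : ℂ)) (hpow χ hχ (k + 1)))
  refine ⟨m, ?_⟩
  rw [← nsmul_eq_mul, charEval_nsmul]
  exact Circle.ext (by rw [← hm, Circle.coe_pow])

/-- The multipliers in `ℤ_p` that work at `p ^ (-k)` form nested nonempty compact sets. A common one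
works everywhere, because `ℚ_p` is generated by `ℤ_p` and the powers of `1 / p`. -/
theorem exists_padicInt_smul_char {ψ χ : CharDual ℚ_[p]}
    (hψ : ∀ t ∈ PadicInt.subring p, charEval ψ t = 1) (hψ' : charEval ψ ((p : ℚ_[p])⁻¹) ≠ 1)
    (hχ : ∀ t ∈ PadicInt.subring p, charEval χ t = 1) : ∃ a : ℚ_[p], χ = a • ψ := by
  have hp0 : (p : ℚ_[p]) ≠ 0 := by exact_mod_cast (Fact.out : p.Prime).ne_zero
  let A : ℕ → Set ℚ_[p] := fun k => {a | a ∈ PadicInt.subring p ∧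
    charEval χ ((p : ℚ_[p]) ^ k)⁻¹ = charEval ψ (a * ((p : ℚ_[p]) ^ k)⁻¹)}
  have hclosed (k : ℕ) : IsClosed (A k) :=
    (isCompact_padicInt p).isClosed.inter (isClosed_eq continuous_const
      ((continuous_charEval ψ).comp (continuous_mul_const _)))
  have hanti (k : ℕ) : A (k + 1) ⊆ A k := by
    rintro a ⟨ha, h⟩
    refine ⟨ha, ?_⟩
    have h1 := congrArg (· ^ p) h
    simp only [← charEval_nsmul, nsmul_eq_mul] at h1
    have h2 : (p : ℚ_[p]) * ((p : ℚ_[p]) ^ (k + 1))⁻¹ = ((p : ℚ_[p]) ^ k)⁻¹ := by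
      field_simp
      exact (pow_succ' _ _).symm
    rwa [mul_left_comm, h2] at h1
  have hne (k : ℕ) : (A k).Nonempty := by
    obtain ⟨m, hm⟩ := exists_natCast_mul_charEval hψ hψ' hχ k
    exact ⟨m, natCast_mem _ m, hm⟩
  obtain ⟨a, ha⟩ := IsCompact.nonempty_iInter_of_sequence_nonempty_isCompact_isClosed A hanti hne
    ((isCompact_padicInt p).of_isClosed_subset (hclosed 0) fun _ h => h.1) hclosed
  rw [Set.mem_iInter] at ha
  refine ⟨a, charDual_ext fun x => ?_⟩
  rw [smul_charEval, smul_eq_mul]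
  obtain ⟨k, hk⟩ := exists_pow_smul_mem (p := p)
    ((isOpen_padicInt p).mem_nhds (zero_mem (PadicInt.subring p))) x
  let y : ℤ_[p] := ⟨(p : ℚ_[p]) ^ k * x, hk⟩
  obtain ⟨z, hz⟩ := Ideal.mem_span_singleton.1 (y.appr_spec k)
  -- The approximation of `p ^ k * x` modulo `p ^ k` by a natural number writes `x` as a multiple of
  -- `p ^ (-k)` plus a `p`-adic integer.
  have hx : x = y.appr k • ((p : ℚ_[p]) ^ k)⁻¹ + z := by
    have h1 := congrArg (fun w : ℤ_[p] => (w : ℚ_[p])) hz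
    have h2 : (p : ℚ_[p]) ^ k * x - y.appr k = (p : ℚ_[p]) ^ k * z := by
      push_cast at h1
      exact h1
    rw [nsmul_eq_mul]
    field_simp
    linear_combination h2
  rw [hx, charEval_add, charEval_nsmul, hχ z z.2, (ha k).2, mul_add, charEval_add,
    hψ (a * z) (mul_mem (ha k).1 z.2), mul_smul_comm, charEval_nsmul]

/-- Scaling by a power of `p` makes any character trivial on `ℤ_p`; the scaling is undone at the
end. -/
theorem hasGeneratingChar_padic : HasGeneratingChar ℚ_[p] := by
  obtain ⟨ψ, hψ, hψ'⟩ := exists_padic_char p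
  refine ⟨ψ, fun h => hψ' (by rw [h, zero_charEval]), fun χ => ?_⟩
  obtain ⟨k, hk⟩ := exists_pow_smul_char_trivial χ
  obtain ⟨a, ha⟩ := exists_padicInt_smul_char hψ hψ' hk
  have hp0 : (p : ℚ_[p]) ^ k ≠ 0 := pow_ne_zero _ (by exact_mod_cast (Fact.out : p.Prime).ne_zero)
  exact ⟨((p : ℚ_[p]) ^ k)⁻¹ * a, by rw [mul_smul, ← ha, inv_smul_smul₀ hp0]⟩

end PadicChar

/-! ### Locally compact modules over the adele ring -/

variable (P : Set Nat.Primes)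

/-- The inclusion of the real factor of the adele ring. -/
def realIncl : ℝ →ₙ+* Adele P where
  toFun t := (t, 0)
  map_mul' s t := by simp
  map_zero' := rfl
  map_add' s t := by simp

/-- The inclusion of the finite factor of the adele ring. -/
def finIncl : FinAdele P →ₙ+* Adele P where
  toFun a := (0, a)
  map_mul' s t := by simp
  map_zero' := rfl
  map_add' s t := by simp

theorem continuous_realIncl : Continuous (realIncl P) := continuous_id.prodMk continuous_const

theorem continuous_finIncl : Continuous (finIncl P) := continuous_const.prodMk continuous_id

variable {P}

theorem realIncl_one_mul (a : Adele P) : realIncl P 1 * a = realIncl P a.1 :=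
  Prod.ext (one_mul _) (zero_mul _)

theorem finIncl_one_mul (a : Adele P) : finIncl P 1 * a = finIncl P a.2 :=
  Prod.ext (zero_mul _) (one_mul _)

theorem realIncl_one_add_finIncl_one : realIncl P 1 + finIncl P 1 = 1 :=
  Prod.ext (add_zero _) (zero_add _)

theorem realIncl_mul_finIncl (t : ℝ) (a : FinAdele P) : realIncl P t * finIncl P a = 0 :=
  Prod.ext (mul_zero _) (zero_mul _)

theorem zLoc_smul_one (r : ZLoc P) : r • (1 : Adele P) = (((r : ℚ) : ℝ), toFinAdele P r) := by
  refine Prod.ext ?_ ?_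
  · change r • (1 : ℝ) = _
    rw [Algebra.smul_def, mul_one]
    rfl
  · change r • (1 : FinAdele P) = _
    rw [Algebra.smul_def, mul_one]
    rfl

/-! ### Real and finite parts, and their contractions -/

section Module

variable {L : Type*} [AddCommGroup L] [Module (Adele P) L]

theorem cornerProj_add_cornerProj (x : L) :
    (cornerProj (realIncl P) x : L) + cornerProj (finIncl P) x = x := by
  rw [coe_cornerProj, coe_cornerProj, ← add_smul, realIncl_one_add_finIncl_one, one_smul]

theorem cornerProj_finIncl_coe (x : Corner (realIncl P) L) : cornerProj (finIncl P) (x : L) = 0 := by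
  refine Subtype.ext ?_
  rw [coe_cornerProj, ← (mem_corner (realIncl P)).1 x.2, smul_smul, mul_comm,
    realIncl_mul_finIncl, zero_smul]
  rfl

theorem cornerProj_realIncl_coe (x : Corner (finIncl P) L) : cornerProj (realIncl P) (x : L) = 0 := by
  refine Subtype.ext ?_
  rw [coe_cornerProj, ← (mem_corner (finIncl P)).1 x.2, smul_smul, realIncl_mul_finIncl, zero_smul]
  rfl

theorem nsmul_realIncl_smul {m : ℕ} (hm : m ≠ 0) (x : L) :
    m • realIncl P (m : ℝ)⁻¹ • x = realIncl P 1 • x := by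
  rw [← smul_assoc, ← map_nsmul, nsmul_eq_mul, mul_inv_cancel₀ (Nat.cast_ne_zero.2 hm)]

section Contraction

variable [TopologicalSpace L] [ContinuousSMul (Adele P) L]

theorem exists_realIncl_smul_mem {K U : Set L} (hK : IsCompact K) (hU : U ∈ 𝓝 (0 : L)) :
    ∃ m : ℕ, m ≠ 0 ∧ ∀ x ∈ K, realIncl P (m : ℝ)⁻¹ • x ∈ U := by
  have h := eventually_smul_mem (A := Adele P) hK hU
  have ht : Filter.Tendsto (fun m : ℕ => realIncl P (m : ℝ)⁻¹) Filter.atTop (𝓝 0) := by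
    have := ((continuous_realIncl P).tendsto 0).comp (tendsto_inv_atTop_nhds_zero_nat (𝕜 := ℝ))
    rwa [map_zero] at this
  obtain ⟨m, hm, hm0⟩ := ((ht.eventually h).and (Filter.eventually_ne_atTop 0)).exists
  exact ⟨m, hm0, hm⟩

theorem exists_finIncl_smul_mem {K U : Set L} (hK : IsCompact K) (hU : U ∈ 𝓝 (0 : L)) :
    ∃ s ∈ primeMonoid P, ∀ x ∈ K, finIncl P s • x ∈ U := by
  have h := eventually_smul_mem (A := Adele P) hK hU
  have ht := (continuous_finIncl P).tendsto 0
  rw [map_zero] at ht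
  obtain ⟨s, hs, hsU⟩ := exists_natCast_mul_mem (ht.eventually h)
  refine ⟨s, hs, fun x hx => ?_⟩
  have := hsU 1 (one_mem _)
  rw [mul_one] at this
  exact this x hx

end Contraction

variable [Module (ZLoc P) L] [IsScalarTower (ZLoc P) (Adele P) L]

theorem zLoc_smul_eq (r : ZLoc P) (x : L) :
    r • x = ((((r : ℚ) : ℝ), toFinAdele P r) : Adele P) • x := by
  rw [← zLoc_smul_one, smul_assoc, one_smul]

theorem invDenom_smul_finIncl_smul {s : ℕ} (hs : s ∈ primeMonoid P) (x : L) :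
    invDenom hs • finIncl P s • x = finIncl P 1 • x := by
  rw [zLoc_smul_eq, smul_smul]
  congr 1
  refine Prod.ext (mul_zero _) ?_
  change toFinAdele P (invDenom hs) * (s : FinAdele P) = 1
  rw [← map_natCast (toFinAdele P), ← map_mul, mul_comm, natCast_mul_invDenom, map_one]

theorem finIncl_smul_invDenom_smul {s : ℕ} (hs : s ∈ primeMonoid P) (x : L) :
    finIncl P s • invDenom hs • x = finIncl P 1 • x := by
  rw [← invDenom_smul_finIncl_smul hs x, zLoc_smul_eq, zLoc_smul_eq, smul_comm]

variable [TopologicalSpace L] [ContinuousSMul (Adele P) L]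

/-- Each part of `x` is contracted into `K` and then restored by the scalar `m` or `1 / s`. -/
theorem span_eq_top_of_mem_nhds {K : Set L} (hK : K ∈ 𝓝 (0 : L)) :
    Submodule.span (ZLoc P) K = ⊤ := by
  refine eq_top_iff.2 fun x _ => ?_
  rw [← cornerProj_add_cornerProj (P := P) x]
  refine add_mem ?_ ?_
  · obtain ⟨m, hm, h⟩ := exists_realIncl_smul_mem (P := P) (isCompact_singleton (x := x)) hK
    rw [coe_cornerProj, ← nsmul_realIncl_smul hm]
    exact nsmul_mem (Submodule.subset_span (h x rfl)) m
  · obtain ⟨s, hs, h⟩ := exists_finIncl_smul_mem (P := P) (isCompact_singleton (x := x)) hK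
    rw [coe_cornerProj, ← invDenom_smul_finIncl_smul hs]
    exact Submodule.smul_mem _ _ (Submodule.subset_span (h x rfl))

/-- If `x ∈ N`, then `m • x` and `x / s` stay in `K`. Contracting `K` by `1 / m` or `s` brings the
corresponding part of `x` into any given neighbourhood of `0`, so both parts vanish. -/
theorem eq_bot_of_subset_isCompact [T2Space L] {K : Set L} (hK : IsCompact K)
    (N : Submodule (ZLoc P) L) (hN : (N : Set L) ⊆ K) : N = ⊥ := by
  refine (Submodule.eq_bot_iff N).2 fun x hx => ?_
  rw [← cornerProj_add_cornerProj (P := P) x, coe_cornerProj, coe_cornerProj]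
  have h1 : realIncl P 1 • x = 0 := by
    by_contra hne
    obtain ⟨m, hm, h⟩ := exists_realIncl_smul_mem (P := P) hK
      (isOpen_compl_singleton.mem_nhds (show (0 : L) ∈ {realIncl P 1 • x}ᶜ from Ne.symm hne))
    refine h _ (hN (nsmul_mem hx m)) ?_
    rw [← nsmul_realIncl_smul hm, smul_comm]
    rfl
  have h2 : finIncl P 1 • x = 0 := by
    by_contra hne
    obtain ⟨s, hs, h⟩ := exists_finIncl_smul_mem (P := P) hK
      (isOpen_compl_singleton.mem_nhds (show (0 : L) ∈ {finIncl P 1 • x}ᶜ from Ne.symm hne))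
    exact h _ (hN (N.smul_mem (invDenom hs) hx)) (finIncl_smul_invDenom_smul hs x)
  rw [h1, h2, add_zero]

end Module

/-! ### Classification and self-duality over the full adele ring -/

section Classification

variable (P) (L : Type*) [AddCommGroup L] [TopologicalSpace L]
  [IsTopologicalAddGroup L] [T2Space L] [LocallyCompactSpace L]
  [Module (Adele P) L] [ContinuousSMul (Adele P) L]

/-- The dimension of the real component of a module over the adele ring. -/
def realDim : ℕ := Module.finrank ℝ (Corner (realIncl P) L)

theorem nonempty_equiv_prod_padicPowers [Module (ZLoc P) L] [IsScalarTower (ZLoc P) (Adele P) L] :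
    Nonempty (L ≃L[ZLoc P] ((Fin (realDim P L) → ℝ) ×
      PadicPowers P (padicDim P (Corner (finIncl P) L)))) := by
  have := corner_continuousSMul (M := L) (realIncl P) (continuous_realIncl P)
  have := corner_continuousSMul (M := L) (finIncl P) (continuous_finIncl P)
  have : FiniteDimensional ℝ (Corner (realIncl P) L) := .of_locallyCompactSpace ℝ
  let a : Corner (realIncl P) L ≃L[ℝ] (Fin (realDim P L) → ℝ) := (Module.finBasis ℝ _).equivFunL
  obtain ⟨Ψ, hΨ⟩ := exists_padicPowers_equiv P (Corner (finIncl P) L)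
  exact ⟨{
    toFun := fun x => (a (cornerProj (realIncl P) x), Ψ (cornerProj (finIncl P) x))
    map_add' := fun x y => by rw [map_add, map_add, map_add, map_add]; rfl
    map_smul' := fun r x => by
      refine Prod.ext ?_ ?_
      · change a (cornerProj (realIncl P) (r • x)) = r • a (cornerProj (realIncl P) x)
        rw [zLoc_smul_eq, cornerProj_smul _ _ _ (realIncl_one_mul _), map_smul]
        rfl
      · change Ψ (cornerProj (finIncl P) (r • x)) = r • Ψ (cornerProj (finIncl P) x)
        rw [zLoc_smul_eq, cornerProj_smul _ _ _ (finIncl_one_mul _)]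
        ext q i
        exact hΨ _ _ q i
    invFun := fun z => (a.symm z.1 : L) + (Ψ.symm z.2 : Corner (finIncl P) L)
    left_inv := fun x => by
      change (a.symm (a _) : L) + (Ψ.symm (Ψ _) : Corner (finIncl P) L) = x
      rw [ContinuousLinearEquiv.symm_apply_apply, ContinuousAddEquiv.symm_apply_apply]
      exact cornerProj_add_cornerProj x
    right_inv := fun z => by
      refine Prod.ext ?_ ?_
      · change a (cornerProj (realIncl P) (_ + _)) = z.1
        rw [map_add, cornerProj_realIncl_coe, cornerProj_coe, add_zero,
          ContinuousLinearEquiv.apply_symm_apply]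
      · change Ψ (cornerProj (finIncl P) (_ + _)) = z.2
        rw [map_add, cornerProj_finIncl_coe, cornerProj_coe, zero_add,
          ContinuousAddEquiv.apply_symm_apply]
    continuous_toFun := (a.continuous.comp (continuous_cornerProj _)).prodMk
      (Ψ.continuous_toFun.comp (continuous_cornerProj _))
    continuous_invFun :=
      (continuous_subtype_val.comp (a.symm.continuous.comp continuous_fst)).add
        (continuous_subtype_val.comp (Ψ.continuous_invFun.comp continuous_snd)) }⟩

/-- Only dimensions are compared, so the purely algebraic isomorphism `cornerDual` suffices. -/
theorem finrank_corner_charDual {F A : Type*} [NontriviallyNormedField F] [CompleteSpace F]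
    [CommRing A] [TopologicalSpace A] (hF : HasGeneratingChar F) (L : Type*) [AddCommGroup L]
    [TopologicalSpace L] [IsTopologicalAddGroup L] [T2Space L] [LocallyCompactSpace L]
    [Module A L] [ContinuousSMul A L] (e : F →ₙ+* A) (he : Continuous e) :
    Module.finrank F (Corner e (CharDual L)) = Module.finrank F (Corner e L) := by
  have := corner_continuousSMul (M := L) e he
  have : FiniteDimensional F (Corner e L) := .of_locallyCompactSpace F
  rw [(cornerDual e).finrank_eq, finrank_charDual hF]

theorem realDim_charDual : realDim P (CharDual L) = realDim P L :=
  finrank_corner_charDual hasGeneratingChar_real L _ (continuous_realIncl P)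

theorem padicDim_charDual :
    padicDim P (Corner (finIncl P) (CharDual L)) = padicDim P (Corner (finIncl P) L) := by
  funext q
  rw [padicDim, padicDim, (cornerCorner (finIncl P) (padicIncl q)).finrank_eq,
    (cornerCorner (finIncl P) (padicIncl q)).finrank_eq]
  exact finrank_corner_charDual hasGeneratingChar_padic L _
    ((continuous_finIncl P).comp (continuous_padicIncl q))

theorem isSelfDual_of_adele_module [Module (ZLoc P) L] [IsScalarTower (ZLoc P) (Adele P) L] :
    IsSelfDual (ZLoc P) L := by
  have : IsScalarTower (ZLoc P) (Adele P) (CharDual L) := ⟨fun r a χ => charDual_ext fun x => by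
    rw [smul_charEval, smul_charEval, smul_charEval, smul_assoc, zLoc_smul_eq, zLoc_smul_eq,
      smul_comm]⟩
  obtain ⟨e⟩ := nonempty_equiv_prod_padicPowers P L
  have h := nonempty_equiv_prod_padicPowers P (CharDual L)
  -- With equal dimensions, `L` and its dual have literally the same model.
  rw [realDim_charDual, padicDim_charDual] at h
  obtain ⟨e'⟩ := h
  exact ⟨e.trans e'.symm⟩

end Classification

end LocAdele

end

theorem mainTheorem8 (P : Set Nat.Primes) (L : Type*) [AddCommGroup L] [TopologicalSpace L]
    [IsTopologicalAddGroup L] [T2Space L] [LocallyCompactSpace L]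
    [Module (LocAdele.Adele P) L] [ContinuousSMul (LocAdele.Adele P) L]
    [Module (LocAdele.ZLoc P) L] [IsScalarTower (LocAdele.ZLoc P) (LocAdele.Adele P) L] :
    (∃ (n : ℕ) (d : P → ℕ),
      Nonempty (L ≃L[LocAdele.ZLoc P] ((Fin n → ℝ) × LocAdele.PadicPowers P d))) ∧
    LocAdele.IsSelfDual (LocAdele.ZLoc P) L ∧
    LocAdele.IsCompactlyGenerated (LocAdele.ZLoc P) L ∧
    LocAdele.HasNoSmallSubmodules (LocAdele.ZLoc P) L := by
  -- One compact neighbourhood serves both as generating set and as the neighbourhood without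
  -- submodules.
  obtain ⟨K, hK, hK0⟩ := exists_compact_mem_nhds (0 : L)
  exact ⟨⟨_, _, LocAdele.nonempty_equiv_prod_padicPowers P L⟩,
    LocAdele.isSelfDual_of_adele_module P L, ⟨K, hK, LocAdele.span_eq_top_of_mem_nhds hK0⟩,
    ⟨K, hK0, LocAdele.eq_bot_of_subset_isCompact hK⟩⟩
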